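/- Let $d\ge 0$, $n\ge 1$, $m\ge 0$ be integers. A \emph{record} is a pair $(x,y)$ with $x\in\mathbb R^d$, $\|x\|_2\le 1$, $y\in\{-1,1\}$, and a \emph{database} is an $n$-tuple $D=((x_i,y_i))_{i=1}^n$ of records; two databases are \emph{neighbors} if they differ in the value of at most one record. A randomized mechanism $\mathcal M$ (a probability law $\mathcal M(D)$ for each $D$) is \emph{$\epsilon$-differentially private} if $\mathcal M(D)(V)\le e^{\epsilon}\mathcal M(D')(V)$ for all neighbors $D,D'$ and all measurable $V$, and satisfies \emph{$\rho$-zCDP} if the Rényi divergences satisfy $D_a(\mathcal M(D)\|\mathcal M(D'))\le\rho a$ for all neighbors $D,D'$ and all $a\in(1,\infty)$. Let $f:\mathbb R\to\mathbb R$ be convex and twice differentiable with $|f'|\le 1$ and $|f''|\le t$, and put $f(x,y,\theta)=f(y\,\theta^{T}x)$. Let $\phi_1,\phi_2,\phi_3>0$ and $c>\frac{t}{2n(e^{\phi_1}-1)}$, and set $\epsilon'=\phi_1-\log\bigl(1+\frac{t}{2nc}\bigr)>0$. For $\gamma>0$ let $\mathrm{Lap}_k(\gamma)$ be the probability law on $\mathbb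 R^k$ with density proportional to $e^{-\gamma\|b\|_2}$. For $\theta\in\mathbb R^d$ let $$H_D(\theta)=\frac1n\sum_{i=1}^n \nabla^2_\theta f(x_i,y_i,\theta)+2c\,I,\qquad \Sigma_D(\theta)=\frac1n\sum_{i=1}^n\nabla_\theta f(x_i,y_i,\theta)\,[\nabla_\theta f(x_i,y_i,\theta)]^{T}-4c^2\theta\theta^{T},$$ and let $s_H(\theta)$, $s_\Sigma(\theta)$ be (measurable, nonnegative) upper bounds for the $L_2$-sensitivities at $\theta$, i.e. for the suprema over neighbors $D,D'$ of the Frobenius norms $\|H_D(\theta)-H_{D'}(\theta)\|$ and $\|\Sigma_D(\theta)-\Sigma_{D'}(\theta)\|$; for example the sensitivities themselves. The subroutine $\mathrm{PrivSPDMat}(M,s,\phi)$ has two modes. It draws $\eta\in\mathbb R^{d^2}$, in the \emph{differential privacy mode} from $\mathrm{Lap}_{d^2}(\phi/s)$, and in the \emph{zCDP mode} from $N\bigl(0,\frac{s^2}{2\phi}I\bigr)$ (with $\eta=0$ if $s=0$), reshapes $\eta$ to a $d\times d$ matrix $E$, forms $\tilde M=\frac12\bigl((M+E)+(M+E)^{T}\bigr)$,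 and returns $\tilde M$ with each eigenvalue $\lambda$ replaced by $\max(\lambda,2c)$ in an orthonormal eigen-decomposition. Consider the following algorithm on input $D$. 1. (Objective perturbation) Draw $\beta\sim\mathrm{Lap}_d(\epsilon'/2)$ and let $\tilde\theta=\arg\min_\theta\Bigl(\frac1n\sum_{i=1}^n\bigl[f(x_i,y_i,\theta)+c\|\theta\|_2^2\bigr]+\frac1n\beta^{T}\theta\Bigr)$. 2. Draw independently $\tilde H=\mathrm{PrivSPDMat}(H_D(\tilde\theta),s_H(\tilde\theta),\phi_2)$ and $\tilde\Sigma=\mathrm{PrivSPDMat}(\Sigma_D(\tilde\theta),s_\Sigma(\tilde\theta),\phi_3)$. 3. Draw independent $G_1,\dots,G_m\sim N(0,\tilde\Sigma)$ and $\beta_1,\dots,\beta_m\sim\mathrm{Lap}_d(\epsilon'/2)$, and let $\theta^{(i)}=\tilde\theta+\tilde H^{-1}\bigl(G_i+\tfrac1{\sqrt n}\beta_i\bigr)/\sqrt n$. 4. For each coordinate $j$ let $[\theta_L[j],\theta_R[j]]$ be a $(1-\alpha)$-confidence interval for $\theta^{(1)}[j],\dots,\theta^{(m)}[j]$, computed by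 a fixed measurable rule whose interval contains at least a fraction $1-\alpha$ of the $m$ samples. Output $(\theta_L,\theta_R)$. Then in the differential privacy mode the algorithm satisfies $(\phi_1+\phi_2+\phi_3)$-differential privacy, and it satisfies $\bigl(\frac{\phi_1^2}{2}+\phi_2+\phi_3\bigr)$-zCDP (in the zCDP mode, and also in the differential privacy mode). -/

import Mathlib

open MeasureTheory ProbabilityTheory
open scoped ENNReal NNReal Matrix

noncomputable section

namespace PrivCI

/-! ### Databases -/

/-- A record: a feature vector in the unit ball of `ℝ^d` and a target in `{-1, 1}`. -/
structure Record (d : ℕ) where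
  x : EuclideanSpace ℝ (Fin d)
  y : ℝ
  norm_x_le : ‖x‖ ≤ 1
  y_mem : y = 1 ∨ y = -1

/-- A database of `n` records. -/
abbrev Database (d n : ℕ) : Type := Fin n → Record d

/-- Two databases differ on the value of (at most) a single record. -/
def Neighbor {d n : ℕ} (D D' : Database d n) : Prop :=
  ∃ i, ∀ j, j ≠ i → D j = D' j

/-! ### Privacy notions -/

/-- A mechanism, given by the output law on each database, is a genuine randomized mechanism if
each of these laws is a probability measure. -/
def IsMechanism {d n : ℕ} {Ω : Type*} [MeasurableSpace Ω] (M : Database d n → Measure Ω) : Prop :=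
  ∀ D, IsProbabilityMeasure (M D)

/-- Pure `ε`-differential privacy. -/
def IsDP {d n : ℕ} {Ω : Type*} [MeasurableSpace Ω] (ε : ℝ) (M : Database d n → Measure Ω) :
    Prop :=
  IsMechanism M ∧ ∀ D D', Neighbor D D' → ∀ V, MeasurableSet V →
    M D V ≤ ENNReal.ofReal (Real.exp ε) * M D' V

open Classical in
/-- The Rényi divergence `D_a(P ‖ Q) = (a - 1)⁻¹ log ∫ (dP/dQ)^a dQ` of order `a > 1`, equal to
`+∞` if `P` is not absolutely continuous with respect to `Q`. -/
def renyiDiv {Ω : Type*} [MeasurableSpace Ω] (a : ℝ) (P Q : Measure Ω) : EReal :=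
  if P ≪ Q then
    (((a - 1)⁻¹ : ℝ) : EReal) * ENNReal.log (∫⁻ ω, (P.rnDeriv Q ω) ^ a ∂Q)
  else ⊤

/-- `ρ`-zero-concentrated differential privacy. -/
def IsZCDP {d n : ℕ} {Ω : Type*} [MeasurableSpace Ω] (ρ : ℝ) (M : Database d n → Measure Ω) :
    Prop :=
  IsMechanism M ∧ ∀ D D', Neighbor D D' → ∀ a : ℝ, 1 < a →
    renyiDiv a (M D) (M D') ≤ ((ρ * a : ℝ) : EReal)

/-! ### Matrices -/

instance instMeasurableSpaceMatrix {d : ℕ} : MeasurableSpace (Matrix (Fin d) (Fin d) ℝ) :=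
  inferInstanceAs (MeasurableSpace (Fin d → Fin d → ℝ))

/-- A `d × d` matrix as a vector of dimension `d²`, with the Euclidean norm. -/
def toVec {d : ℕ} (M : Matrix (Fin d) (Fin d) ℝ) : EuclideanSpace ℝ (Fin d × Fin d) :=
  WithLp.toLp 2 fun p => M p.1 p.2

/-- Reshape a vector of dimension `d²` to a `d × d` matrix. -/
def toMat {d : ℕ} (v : EuclideanSpace ℝ (Fin d × Fin d)) : Matrix (Fin d) (Fin d) ℝ :=
  Matrix.of fun i j => v (i, j)

/-- The `L₂`-sensitivity of a matrix-valued function of the database: the supremum of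
`‖F D - F D'‖₂` over neighboring databases. -/
def l2Sensitivity {d n : ℕ} (F : Database d n → Matrix (Fin d) (Fin d) ℝ) : ℝ≥0∞ :=
  ⨆ (D : Database d n) (D' : Database d n) (_ : Neighbor D D'), ‖toVec (F D) - toVec (F D')‖ₑ

/-- `(M + Mᵀ) / 2`. -/
def symPart {d : ℕ} (M : Matrix (Fin d) (Fin d) ℝ) : Matrix (Fin d) (Fin d) ℝ :=
  (2⁻¹ : ℝ) • (M + Mᵀ)

theorem symPart_isHermitian {d : ℕ} (M : Matrix (Fin d) (Fin d) ℝ) :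
    (symPart M).IsHermitian := by
  ext i j
  simp [symPart, add_comm, mul_add]

/-- For a symmetric `A = V diag(Λ) Vᵀ`, replace each eigenvalue `Λ i` by `max (Λ i) r`. -/
def clipEigenvalues {d : ℕ} (r : ℝ) (A : Matrix (Fin d) (Fin d) ℝ) (hA : A.IsHermitian) :
    Matrix (Fin d) (Fin d) ℝ :=
  (hA.eigenvectorUnitary : Matrix (Fin d) (Fin d) ℝ) *
    Matrix.diagonal (fun i => max (hA.eigenvalues i) r) *
    (hA.eigenvectorUnitary : Matrix (Fin d) (Fin d) ℝ)ᵀ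

/-! ### Noise distributions -/

/-- The probability law on `ℝ^ι` with density `u⁻¹ exp (-γ ‖b‖₂)`, where `u` is the normalizing
constant (`γ > 0`). -/
def sphericalLaplace (ι : Type*) [Fintype ι] (γ : ℝ) : Measure (EuclideanSpace ℝ ι) :=
  (∫⁻ b : EuclideanSpace ℝ ι, ENNReal.ofReal (Real.exp (-γ * ‖b‖)))⁻¹ •
    (volume : Measure (EuclideanSpace ℝ ι)).withDensity
      fun b => ENNReal.ofReal (Real.exp (-γ * ‖b‖))

/-- The privacy definition for which the matrix noise is calibrated. -/
inductive Mode
  | pureDP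
  | zCDP

open Classical in
/-- The `d²`-dimensional noise vector of `privSPDMat`: spherical Laplace with `γ = φ / s` for pure
differential privacy, `N(0, s² / (2 φ) I)` for zCDP. If the sensitivity `s` is zero, there is no
noise (for the Gaussian this is the meaning of zero variance). -/
def matrixNoise (d : ℕ) (mode : Mode) (s : ℝ≥0) (φ : ℝ) :
    Measure (EuclideanSpace ℝ (Fin d × Fin d)) :=
  match mode with
  | .pureDP =>
      if s = 0 then Measure.dirac 0 else sphericalLaplace (Fin d × Fin d) (φ / s)
  | .zCDP =>
      (Measure.pi fun _ : Fin d × Fin d => gaussianReal 0 (s ^ 2 / (2 * φ.toNNReal))).map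
        (WithLp.toLp 2)

/-- Private symmetric positive definite matrix: output law on the matrix `M`, with sensitivity
`s`, budget `φ` and eigenvalue threshold `2 c`. -/
def privSPDMat {d : ℕ} (mode : Mode) (M : Matrix (Fin d) (Fin d) ℝ) (s : ℝ≥0) (φ c : ℝ) :
    Measure (Matrix (Fin d) (Fin d) ℝ) :=
  (matrixNoise d mode s φ).map fun η =>
    clipEigenvalues (2 * c) (symPart (M + toMat η)) (symPart_isHermitian _)

/-! ### Objective perturbation -/

/-- The loss `θ ↦ f (y θᵀ x)` of a record. -/
def loss {d : ℕ} (f : ℝ → ℝ) (r : Record d) (θ : EuclideanSpace ℝ (Fin d)) : ℝ :=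
  f (r.y * inner ℝ θ r.x)

/-- `J_n(θ) = (1/n) ∑ᵢ [f(xᵢ, yᵢ, θ) + c ‖θ‖²] + (1/n) βᵀ θ`. -/
def objective {d n : ℕ} (f : ℝ → ℝ) (c : ℝ) (D : Database d n) (β θ : EuclideanSpace ℝ (Fin d)) :
    ℝ :=
  (1 / n : ℝ) * ∑ i, (loss f (D i) θ + c * ‖θ‖ ^ 2) + (1 / n : ℝ) * inner ℝ β θ

/-- A minimizer of `g` (it exists and is unique for the objectives considered here). -/
def argmin {d : ℕ} (g : EuclideanSpace ℝ (Fin d) → ℝ) : EuclideanSpace ℝ (Fin d) :=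
  Classical.epsilon fun θ => ∀ θ', g θ ≤ g θ'

/-- `ε' = ε - log (1 + t / (2 n c))`. -/
def epsPrime (n : ℕ) (ε t c : ℝ) : ℝ :=
  ε - Real.log (1 + t / (2 * n * c))

/-- Objective perturbation: output law on the database `D`. -/
def objPerturb {d n : ℕ} (f : ℝ → ℝ) (ε t c : ℝ) (D : Database d n) :
    Measure (EuclideanSpace ℝ (Fin d)) :=
  (sphericalLaplace (Fin d) (epsPrime n ε t c / 2)).map fun β => argmin (objective f c D β)

/-! ### Confidence intervals -/

/-- The Hessian matrix of `g` at `θ`. -/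
def hessian {d : ℕ} (g : EuclideanSpace ℝ (Fin d) → ℝ) (θ : EuclideanSpace ℝ (Fin d)) :
    Matrix (Fin d) (Fin d) ℝ :=
  Matrix.of fun i j =>
    fderiv ℝ (fun w => fderiv ℝ g w (EuclideanSpace.single j 1)) θ (EuclideanSpace.single i 1)

/-- `H[J_n(θ)] = (1/n) ∑ᵢ H[f(xᵢ, yᵢ, θ)] + 2 c I`. -/
def hessianMat {d n : ℕ} (f : ℝ → ℝ) (c : ℝ) (θ : EuclideanSpace ℝ (Fin d)) (D : Database d n) :
    Matrix (Fin d) (Fin d) ℝ :=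
  (1 / n : ℝ) • ∑ i, hessian (loss f (D i)) θ + (2 * c) • (1 : Matrix (Fin d) (Fin d) ℝ)

/-- `Σ = (1/n) ∑ᵢ ∇f(xᵢ, yᵢ, θ) ∇f(xᵢ, yᵢ, θ)ᵀ - 4 c² θ θᵀ`. -/
def covMat {d n : ℕ} (f : ℝ → ℝ) (c : ℝ) (θ : EuclideanSpace ℝ (Fin d)) (D : Database d n) :
    Matrix (Fin d) (Fin d) ℝ :=
  (1 / n : ℝ) • ∑ i, Matrix.vecMulVec (gradient (loss f (D i)) θ).ofLp
      (gradient (loss f (D i)) θ).ofLp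
    - (4 * c ^ 2) • Matrix.vecMulVec θ.ofLp θ.ofLp

/-- A rule that turns `m` real samples into a `(1 - α)`-confidence interval for them: the
interval covers at least a fraction `1 - α` of the samples. -/
structure IsIntervalRule {m : ℕ} (α : ℝ) (ci : (Fin m → ℝ) → ℝ × ℝ) : Prop where
  measurable : Measurable ci
  covers : ∀ z, (1 - α) * m ≤ ({i | z i ∈ Set.Icc (ci z).1 (ci z).2} : Set (Fin m)).ncard

/-- `θ̃ + H̃⁻¹ (G + β / √n) / √n`. -/
def resample {d : ℕ} (n : ℕ) (θ : EuclideanSpace ℝ (Fin d)) (H : Matrix (Fin d) (Fin d) ℝ)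
    (G β : EuclideanSpace ℝ (Fin d)) : EuclideanSpace ℝ (Fin d) :=
  θ + (1 / √n : ℝ) • WithLp.toLp 2 (H⁻¹ *ᵥ (G + (1 / √n : ℝ) • β).ofLp)

/-- Private confidence intervals for models trained with objective perturbation: law of the output
`(θ_L, θ_R)` on the database `D`. Here `m` is the number of post-processing samples, `ci` is the
rule that computes the interval of each coordinate, and `sH θ`, `sC θ` are the sensitivities
passed to `privSPDMat` when the released parameter is `θ`. -/
def confidenceIntervals {d n m : ℕ} (mode : Mode) (f : ℝ → ℝ) (t c φ₁ φ₂ φ₃ : ℝ)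
    (sH sC : EuclideanSpace ℝ (Fin d) → ℝ≥0) (ci : (Fin m → ℝ) → ℝ × ℝ) (D : Database d n) :
    Measure ((Fin d → ℝ) × (Fin d → ℝ)) :=
  (objPerturb f φ₁ t c D).bind fun θ =>
  (privSPDMat mode (hessianMat f c θ D) (sH θ) φ₂ c).bind fun H =>
  (privSPDMat mode (covMat f c θ D) (sC θ) φ₃ c).bind fun S =>
  (Measure.pi fun _ : Fin m => multivariateGaussian 0 S).bind fun G =>
  (Measure.pi fun _ : Fin m => sphericalLaplace (Fin d) (epsPrime n φ₁ t c / 2)).map fun B =>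
    (fun j => (ci fun i => resample n θ H (G i) (B i) j).1,
     fun j => (ci fun i => resample n θ H (G i) (B i) j).2)

end PrivCI

end

/-!
A bound on the Rényi divergence of order `p` of `P` from `Q` is, in dual form, a bound on the norm
of integration against `P` as a functional on `L^q(Q)`, where `1 / p + 1 / q = 1`. In this form it
passes through adaptive composition by integrating stage by stage, the constants multiply, and pure
differential privacy is the case `q = 1`. So it suffices to treat the three private stages.

For the two matrices, changing the database translates the noise by at most the sensitivity, and
clipping the eigenvalues is post-processing. For objective perturbation, the noise is recovered from
the minimizer by the first-order condition, so the law of the minimizer is given by a change of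
variables: exchanging one record moves the noise by at most `2`, which costs a factor `exp ε'`, and
changes the Jacobian by a matrix of rank one, which costs a factor `1 + t / (2 n c)`; the product of
the two is `exp ε`. Finally, `ε`-differential privacy gives `ε² / 2`-zCDP by Hoeffding's lemma for
the log-likelihood ratio, applied once to bound its mean and once to bound its moment generating
function.
-/

namespace PrivCI

section HolderDom

variable {Ω Ω' : Type*} [MeasurableSpace Ω] [MeasurableSpace Ω'] {P Q : Measure Ω} {C C' : ℝ≥0∞}
  {p q : ℝ}

/-- Hölder domination: integration against `P` has norm at most `C` as a functional on `L^q(Q)`.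
For `q = 1` this is `P ≤ C • Q`, the relation of pure differential privacy; for `q > 1` it is the
dual form of the bound `C` on the `L^p(Q)`-norm of `dP/dQ`, where `p` is the conjugate exponent. -/
def HolderDom (q : ℝ) (C : ℝ≥0∞) (P Q : Measure Ω) : Prop :=
  ∀ g : Ω → ℝ≥0∞, Measurable g → ∫⁻ ω, g ω ∂P ≤ C * (∫⁻ ω, g ω ^ q ∂Q) ^ (1 / q)

theorem holderDom_one_iff : HolderDom 1 C P Q ↔ P ≤ C • Q := by
  simp only [HolderDom, ENNReal.rpow_one, div_one]
  refine ⟨fun h => Measure.le_iff.2 fun s hs => ?_, fun h g _ => ?_⟩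
  · simpa only [lintegral_indicator_one hs] using! h _ (measurable_one.indicator hs)
  · simpa only [lintegral_smul_measure, smul_eq_mul] using lintegral_mono' h (le_refl g)

namespace HolderDom

theorem mono (h : HolderDom q C P Q) (hC : C ≤ C') : HolderDom q C' P Q :=
  fun g hg => (h g hg).trans (by gcongr)

theorem refl (hq : 1 ≤ q) (P : Measure Ω) [IsProbabilityMeasure P] : HolderDom q 1 P P := by
  intro g hg
  simpa [eLpNorm'] using
    eLpNorm'_le_eLpNorm'_of_exponent_le zero_lt_one hq P hg.aestronglyMeasurable

theorem of_one (hq : 1 ≤ q) [IsProbabilityMeasure P] (h : HolderDom 1 C P Q) :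
    HolderDom q (C ^ (1 / q)) P Q := by
  intro g hg
  have hq' : 0 ≤ 1 / q := by positivity
  calc ∫⁻ ω, g ω ∂P ≤ (∫⁻ ω, g ω ^ q ∂P) ^ (1 / q) := by simpa using refl hq P g hg
    _ ≤ (C * ∫⁻ ω, g ω ^ q ∂Q) ^ (1 / q) := by
        gcongr
        simpa using h _ (hg.pow_const q)
    _ = C ^ (1 / q) * (∫⁻ ω, g ω ^ q ∂Q) ^ (1 / q) := ENNReal.mul_rpow_of_nonneg _ _ hq'

theorem withDensity (hpq : p.HolderConjugate q) (Q : Measure Ω) {Z : Ω → ℝ≥0∞}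
    (hZ : Measurable Z) : HolderDom q ((∫⁻ ω, Z ω ^ p ∂Q) ^ (1 / p)) (Q.withDensity Z) Q := by
  intro g hg
  rw [lintegral_withDensity_eq_lintegral_mul _ hZ hg]
  exact ENNReal.lintegral_mul_le_Lp_mul_Lq Q hpq hZ.aemeasurable hg.aemeasurable

theorem map (h : HolderDom q C P Q) {F : Ω → Ω'} (hF : Measurable F) :
    HolderDom q C (P.map F) (Q.map F) := by
  intro g hg
  rw [lintegral_map hg hF, lintegral_map (hg.pow_const q) hF]
  exact h _ (hg.comp hF)

theorem compProd [SFinite P] [SFinite Q] {κ η : Kernel Ω Ω'} [IsSFiniteKernel κ]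
    [IsSFiniteKernel η] (hq : 0 < q) (h : HolderDom q C P Q)
    (hκη : ∀ ω, HolderDom q C' (κ ω) (η ω)) :
    HolderDom q (C * C') (P ⊗ₘ κ) (Q ⊗ₘ η) := by
  intro g hg
  have hm : Measurable fun ω => (∫⁻ x, g (ω, x) ^ q ∂η ω) ^ (1 / q) :=
    (hg.pow_const q).lintegral_kernel_prod_right'.pow_const _
  rw [Measure.lintegral_compProd hg, Measure.lintegral_compProd (hg.pow_const q)]
  calc ∫⁻ ω, ∫⁻ x, g (ω, x) ∂κ ω ∂P
      ≤ ∫⁻ ω, C' * (∫⁻ x, g (ω, x) ^ q ∂η ω) ^ (1 / q) ∂P :=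
        lintegral_mono fun ω => hκη ω _ (hg.comp measurable_prodMk_left)
    _ = C' * ∫⁻ ω, (∫⁻ x, g (ω, x) ^ q ∂η ω) ^ (1 / q) ∂P := lintegral_const_mul _ hm
    _ ≤ C' * (C * (∫⁻ ω, ((∫⁻ x, g (ω, x) ^ q ∂η ω) ^ (1 / q)) ^ q ∂Q) ^ (1 / q)) := by
        gcongr
        exact h _ hm
    _ = C * C' * (∫⁻ ω, ∫⁻ x, g (ω, x) ^ q ∂η ω ∂Q) ^ (1 / q) := by
        simp_rw [← ENNReal.rpow_mul, one_div_mul_cancel hq.ne', ENNReal.rpow_one]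
        ring

theorem prod {P' Q' : Measure Ω'} [SFinite P] [SFinite Q] [SFinite P'] [SFinite Q'] (hq : 0 < q)
    (h : HolderDom q C P Q) (h' : HolderDom q C' P' Q') :
    HolderDom q (C * C') (P.prod P') (Q.prod Q') := by
  simpa only [Measure.compProd_const] using
    h.compProd (κ := Kernel.const Ω P') (η := Kernel.const Ω Q') hq fun _ => h'

theorem bind [SFinite P] [SFinite Q] (hq : 1 ≤ q) (h : HolderDom q C P Q) (κ : Kernel Ω Ω')
    [IsMarkovKernel κ] : HolderDom q C (P.bind κ) (Q.bind κ) := by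
  have := (h.compProd (zero_lt_one.trans_le hq) fun ω => refl hq (κ ω)).map measurable_snd
  rw [mul_one] at this
  simpa only [← Measure.snd_compProd, Measure.snd] using this

theorem absolutelyContinuous (hq : 0 < q) (h : HolderDom q C P Q) : P ≪ Q := by
  refine Measure.AbsolutelyContinuous.mk fun s hs h0 => ?_
  have hpow : (fun ω => s.indicator (1 : Ω → ℝ≥0∞) ω ^ q) = s.indicator 1 := by
    ext ω
    by_cases hω : ω ∈ s <;> simp [hω, hq]
  simpa [hpow, lintegral_indicator_one hs, h0, hq] using h _ (measurable_one.indicator hs)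

theorem lintegral_rpow_le (hpq : p.HolderConjugate q) (h : HolderDom q C P Q) {Y : Ω → ℝ≥0∞}
    (hY : Measurable Y) (hYP : Q.withDensity Y ≤ P) (hfin : ∫⁻ ω, Y ω ^ p ∂Q ≠ ∞) :
    ∫⁻ ω, Y ω ^ p ∂Q ≤ C ^ p := by
  set I := ∫⁻ ω, Y ω ^ p ∂Q with hI
  rcases eq_or_ne I 0 with h0 | h0
  · simp [h0]
  have hIq : I ^ (1 / q) ≠ 0 := by simp [h0, hfin]
  have hIq' : I ^ (1 / q) ≠ ∞ :=
    ENNReal.rpow_ne_top_of_nonneg (one_div_nonneg.2 hpq.symm.nonneg) hfin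
  have hle : I ≤ C * I ^ (1 / q) := by
    have hm : Measurable fun ω => Y ω ^ (p - 1) := hY.pow_const _
    calc I = ∫⁻ ω, Y ω ^ (p - 1) ∂Q.withDensity Y := by
          rw [lintegral_withDensity_eq_lintegral_mul _ hY hm]
          refine lintegral_congr fun ω => ?_
          conv_lhs => rw [← add_sub_cancel 1 p, ENNReal.rpow_add_of_nonneg _ _ zero_le_one
            (sub_pos.2 hpq.lt).le, ENNReal.rpow_one]
          rfl
      _ ≤ ∫⁻ ω, Y ω ^ (p - 1) ∂P := lintegral_mono' hYP le_rfl
      _ ≤ C * (∫⁻ ω, (Y ω ^ (p - 1)) ^ q ∂Q) ^ (1 / q) := h _ hm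
      _ = C * I ^ (1 / q) := by simp_rw [← ENNReal.rpow_mul, hpq.sub_one_mul_conj, hI]
  have hsplit : I = I ^ (1 / p) * I ^ (1 / q) := by
    rw [← ENNReal.rpow_add _ _ h0 hfin, one_div, one_div, hpq.inv_add_inv_eq_one,
      ENNReal.rpow_one]
  have hroot : I ^ (1 / p) ≤ C :=
    (ENNReal.mul_le_mul_iff_left hIq hIq').1 (hsplit.symm.trans_le hle)
  calc I = (I ^ (1 / p)) ^ p := by
        rw [← ENNReal.rpow_mul, one_div_mul_cancel hpq.ne_zero, ENNReal.rpow_one]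
    _ ≤ C ^ p := ENNReal.rpow_le_rpow hroot hpq.nonneg

theorem lintegral_rnDeriv_rpow_le [IsFiniteMeasure Q] (hpq : p.HolderConjugate q)
    (h : HolderDom q C P Q) : ∫⁻ ω, P.rnDeriv Q ω ^ p ∂Q ≤ C ^ p := by
  let Y (N : ℕ) (ω : Ω) : ℝ≥0∞ := min (P.rnDeriv Q ω) N
  have hY (N : ℕ) : Measurable (Y N) := (Measure.measurable_rnDeriv P Q).min measurable_const
  have hmono (ω : Ω) : Monotone fun N => Y N ω ^ p := fun N N' hN =>
    ENNReal.rpow_le_rpow (min_le_min le_rfl (by exact_mod_cast hN)) hpq.nonneg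
  have htrunc (N : ℕ) : ∫⁻ ω, Y N ω ^ p ∂Q ≤ C ^ p := by
    refine h.lintegral_rpow_le hpq (hY N) ((withDensity_mono (ae_of_all _ fun ω =>
      min_le_left _ _)).trans (Measure.withDensity_rnDeriv_le P Q)) (ne_top_of_le_ne_top ?_
      (lintegral_mono fun ω => ENNReal.rpow_le_rpow (min_le_right _ (N : ℝ≥0∞)) hpq.nonneg))
    simp [lintegral_const, ENNReal.mul_eq_top, ENNReal.rpow_eq_top_iff, hpq.nonneg.not_gt]
  have hlim (ω : Ω) : Filter.Tendsto (fun N => Y N ω ^ p) Filter.atTop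
      (nhds (P.rnDeriv Q ω ^ p)) := by
    refine (ENNReal.continuous_rpow_const.tendsto _).comp ?_
    simpa using (tendsto_const_nhds (x := P.rnDeriv Q ω)).min ENNReal.tendsto_nat_nhds_top
  exact le_of_tendsto' (lintegral_tendsto_of_tendsto_of_monotone
    (fun N => ((hY N).pow_const p).aemeasurable) (ae_of_all _ hmono) (ae_of_all _ hlim)) htrunc

theorem renyiDiv_le {a ρ : ℝ} [IsFiniteMeasure Q] (haq : a.HolderConjugate q)
    (h : HolderDom q (ENNReal.ofReal (Real.exp (ρ * (a - 1)))) P Q) :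
    renyiDiv a P Q ≤ ((ρ * a : ℝ) : EReal) := by
  have ha : 0 < a - 1 := sub_pos.2 haq.lt
  have hlog : ENNReal.log (∫⁻ ω, P.rnDeriv Q ω ^ a ∂Q) ≤ ((ρ * (a - 1) * a : ℝ) : EReal) := by
    have hI := ENNReal.log_le_log (h.lintegral_rnDeriv_rpow_le haq)
    rwa [ENNReal.ofReal_rpow_of_pos (Real.exp_pos _), ← Real.exp_mul,
      ENNReal.log_ofReal_of_pos (Real.exp_pos _), Real.log_exp] at hI
  rw [renyiDiv, if_pos (h.absolutelyContinuous haq.symm.pos)]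
  calc (((a - 1)⁻¹ : ℝ) : EReal) * ENNReal.log (∫⁻ ω, P.rnDeriv Q ω ^ a ∂Q)
      ≤ (((a - 1)⁻¹ : ℝ) : EReal) * ((ρ * (a - 1) * a : ℝ) : EReal) :=
        mul_le_mul_of_nonneg_left hlog (by exact_mod_cast (inv_pos.2 ha).le)
    _ = ((ρ * a : ℝ) : EReal) := by
        rw [← EReal.coe_mul]
        congr 1
        field_simp

end HolderDom

end HolderDom

section PureToConcentrated

variable {Ω : Type*} [MeasurableSpace Ω] {P Q : Measure Ω}

theorem mgf_le_of_mem_Icc_of_mgf_neg_one [IsProbabilityMeasure P] {X : Ω → ℝ} {l r s : ℝ}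
    (hX : AEMeasurable X P) (hlr : ∀ᵐ ω ∂P, X ω ∈ Set.Icc l r) (h1 : mgf X P (-1) = 1)
    (hs : 0 ≤ s) : mgf X P s ≤ Real.exp (s * (s + 1) * ((r - l) / 2) ^ 2 / 2) := by
  have hoeffding (u : ℝ) :
      mgf X P u ≤ Real.exp (u * P[X] + u ^ 2 * ((r - l) / 2) ^ 2 / 2) := by
    have h := (hasSubgaussianMGF_of_mem_Icc hX hlr).mgf_le u
    simp_rw [sub_eq_add_neg] at h
    rw [mgf_add_const, mul_neg, Real.exp_neg, ← div_eq_mul_inv, div_le_iff₀ (Real.exp_pos _),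
      ← Real.exp_add] at h
    refine h.trans_eq (congrArg Real.exp ?_)
    push_cast
    rw [div_pow, Real.norm_eq_abs, sq_abs]
    ring
  have hmean : P[X] ≤ ((r - l) / 2) ^ 2 / 2 := by
    have := Real.one_le_exp_iff.1 (h1 ▸ hoeffding (-1))
    linarith
  refine (hoeffding s).trans (Real.exp_le_exp.2 ?_)
  linarith [mul_le_mul_of_nonneg_left hmean hs]

theorem rnDeriv_le_of_le_smul [SigmaFinite Q] {K : ℝ≥0∞} (h : P ≤ K • Q) :
    P.rnDeriv Q ≤ᵐ[Q] fun _ => K :=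
  ae_le_of_forall_setLIntegral_le_of_sigmaFinite (P.measurable_rnDeriv Q) fun s _ _ => by
    simpa using (Measure.setLIntegral_rnDeriv_le s).trans (h s)

theorem llr_le_of_le_smul [SigmaFinite P] [SigmaFinite Q] {ε : ℝ}
    (h : P ≤ ENNReal.ofReal (Real.exp ε) • Q) : ∀ᵐ ω ∂P, llr P Q ω ≤ ε := by
  have hPQ : P ≪ Q := Measure.absolutelyContinuous_of_le_smul h
  filter_upwards [hPQ.ae_le (rnDeriv_le_of_le_smul h), exp_llr_of_ac P Q hPQ] with ω hle hexp
  rw [← Real.exp_le_exp, hexp]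
  exact ENNReal.toReal_le_of_le_ofReal (Real.exp_pos _).le hle

theorem mgf_llr_neg_one [IsFiniteMeasure P] [IsProbabilityMeasure Q] (hPQ : P ≪ Q) (hQP : Q ≪ P) :
    mgf (llr P Q) P (-1) = 1 := by
  have hexp : (fun ω => Real.exp (-1 * llr P Q ω)) =ᵐ[P] fun ω => (Q.rnDeriv P ω).toReal := by
    simpa only [neg_one_mul] using exp_neg_llr hPQ
  rw [mgf, integral_congr_ae hexp, Measure.integral_toReal_rnDeriv hQP, probReal_univ]

theorem lintegral_rnDeriv_rpow_eq_mgf_llr [IsFiniteMeasure P] [SigmaFinite Q] {a : ℝ} (ha : 1 < a)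
    (hPQ : P ≪ Q) (hint : Integrable (fun ω => Real.exp ((a - 1) * llr P Q ω)) P) :
    ∫⁻ ω, P.rnDeriv Q ω ^ a ∂Q = ENNReal.ofReal (mgf (llr P Q) P (a - 1)) := by
  have hpow : ∀ᵐ ω ∂P, P.rnDeriv Q ω ^ (a - 1) =
      ENNReal.ofReal (Real.exp ((a - 1) * llr P Q ω)) := by
    filter_upwards [exp_llr_of_ac P Q hPQ, Measure.rnDeriv_pos hPQ,
      hPQ.ae_le (P.rnDeriv_lt_top Q)] with ω hexp hpos hlt
    rw [mul_comm, Real.exp_mul, hexp, ← ENNReal.ofReal_rpow_of_pos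
      (ENNReal.toReal_pos hpos.ne' hlt.ne), ENNReal.ofReal_toReal hlt.ne]
  calc ∫⁻ ω, P.rnDeriv Q ω ^ a ∂Q = ∫⁻ ω, P.rnDeriv Q ω * P.rnDeriv Q ω ^ (a - 1) ∂Q := by
        refine lintegral_congr fun ω => ?_
        conv_lhs => rw [← add_sub_cancel 1 a, ENNReal.rpow_add_of_nonneg _ _ zero_le_one
          (sub_pos.2 ha).le, ENNReal.rpow_one]
    _ = ∫⁻ ω, P.rnDeriv Q ω ^ (a - 1) ∂P :=
        lintegral_rnDeriv_mul hPQ ((P.measurable_rnDeriv Q).pow_const _).aemeasurable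
    _ = ∫⁻ ω, ENNReal.ofReal (Real.exp ((a - 1) * llr P Q ω)) ∂P := lintegral_congr_ae hpow
    _ = ENNReal.ofReal (mgf (llr P Q) P (a - 1)) :=
        (ofReal_integral_eq_lintegral_ofReal hint (ae_of_all _ fun _ => (Real.exp_pos _).le)).symm

theorem HolderDom.of_le_smul_of_le_smul [IsProbabilityMeasure P] [IsProbabilityMeasure Q]
    {ε a q : ℝ} (haq : a.HolderConjugate q) (hPQ : P ≤ ENNReal.ofReal (Real.exp ε) • Q)
    (hQP : Q ≤ ENNReal.ofReal (Real.exp ε) • P) :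
    HolderDom q (ENNReal.ofReal (Real.exp (ε ^ 2 / 2 * (a - 1)))) P Q := by
  have hac : P ≪ Q := Measure.absolutelyContinuous_of_le_smul hPQ
  have hac' : Q ≪ P := Measure.absolutelyContinuous_of_le_smul hQP
  have hm : AEMeasurable (llr P Q) P := (measurable_llr P Q).aemeasurable
  have hmem : ∀ᵐ ω ∂P, llr P Q ω ∈ Set.Icc (-ε) ε := by
    filter_upwards [llr_le_of_le_smul hPQ, hac.ae_le (llr_le_of_le_smul hQP), neg_llr hac]
      with ω hle hge hneg
    rw [← hneg] at hge
    exact ⟨neg_le.1 hge, hle⟩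
  have hmgf : mgf (llr P Q) P (a - 1) ≤ Real.exp (ε ^ 2 / 2 * (a - 1) * a) := by
    refine (mgf_le_of_mem_Icc_of_mgf_neg_one hm hmem (mgf_llr_neg_one hac hac')
      (sub_pos.2 haq.lt).le).trans_eq (congrArg Real.exp ?_)
    ring
  have hmoment : ∫⁻ ω, P.rnDeriv Q ω ^ a ∂Q ≤
      ENNReal.ofReal (Real.exp (ε ^ 2 / 2 * (a - 1) * a)) := by
    rw [lintegral_rnDeriv_rpow_eq_mgf_llr haq.lt hac (integrable_exp_mul_of_mem_Icc hm hmem)]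
    exact ENNReal.ofReal_le_ofReal hmgf
  have h := HolderDom.withDensity haq Q (P.measurable_rnDeriv Q)
  rw [Measure.withDensity_rnDeriv_eq P Q hac] at h
  refine h.mono ((ENNReal.rpow_le_rpow hmoment (one_div_nonneg.2 haq.nonneg)).trans_eq ?_)
  rw [ENNReal.ofReal_rpow_of_pos (Real.exp_pos _), ← Real.exp_mul, mul_one_div,
    mul_div_cancel_right₀ _ haq.ne_zero]

end PureToConcentrated

section ChangeOfVariables

variable {E : Type*} [NormedAddCommGroup E] [NormedSpace ℝ E] [FiniteDimensional ℝ E]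
  [MeasurableSpace E] [BorelSpace E] {S T : E → E} {T' : E → E →L[ℝ] E}

theorem measurable_of_inverse_hasFDerivAt (hST : Function.LeftInverse S T)
    (hTS : Function.RightInverse S T) (hT : ∀ x, HasFDerivAt T (T' x) x) : Measurable S :=
  fun s hs => by
    rw [← Set.image_eq_preimage_of_inverse hST hTS]
    exact measurable_image_of_fderivWithin hs (fun x _ => (hT x).hasFDerivWithinAt)
      hST.injective.injOn

theorem map_withDensity_eq_of_inverse (μ : Measure E) [μ.IsAddHaarMeasure]
    (hST : Function.LeftInverse S T) (hTS : Function.RightInverse S T)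
    (hT : ∀ x, HasFDerivAt T (T' x) x) (g : E → ℝ≥0∞) :
    (μ.withDensity g).map S =
      μ.withDensity fun x => ENNReal.ofReal |(T' x).det| * g (T x) := by
  have hS := measurable_of_inverse_hasFDerivAt hST hTS hT
  ext s hs
  rw [Measure.map_apply hS hs, withDensity_apply _ (hS hs), withDensity_apply _ hs,
    ← Set.image_eq_preimage_of_inverse hST hTS]
  exact lintegral_image_eq_lintegral_abs_det_fderiv_mul μ hs
    (fun x _ => (hT x).hasFDerivWithinAt) hST.injective.injOn g

end ChangeOfVariables

section SphericalLaplace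

variable {ι : Type*} [Fintype ι] {γ : ℝ}

theorem integrable_exp_neg_mul_norm {E : Type*} [NormedAddCommGroup E] [NormedSpace ℝ E]
    [FiniteDimensional ℝ E] [MeasurableSpace E] [BorelSpace E] (μ : Measure E)
    [μ.IsAddHaarMeasure] (hγ : 0 < γ) : Integrable (fun b => Real.exp (-γ * ‖b‖)) μ := by
  set k : ℕ := Module.finrank ℝ E + 1 with hk
  have hint := integrable_one_add_norm (E := E) (μ := μ) (r := k) (by rw [hk]; push_cast; linarith)
  refine (hint.const_mul (Real.exp γ * k.factorial / γ ^ k)).mono'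
    (by fun_prop) (ae_of_all _ fun b => ?_)
  have hb : 0 < 1 + ‖b‖ := by positivity
  have hpow := Real.pow_div_factorial_le_exp (γ * (1 + ‖b‖)) (by positivity) k
  rw [Real.norm_of_nonneg (Real.exp_pos _).le, Real.rpow_neg hb.le, Real.rpow_natCast]
  calc Real.exp (-γ * ‖b‖) = Real.exp γ * (Real.exp (γ * (1 + ‖b‖)))⁻¹ := by
        rw [← Real.exp_neg, ← Real.exp_add]
        ring_nf
    _ ≤ Real.exp γ * ((γ * (1 + ‖b‖)) ^ k / k.factorial)⁻¹ := by gcongr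
    _ = Real.exp γ * k.factorial / γ ^ k * ((1 + ‖b‖) ^ k)⁻¹ := by
        rw [mul_pow]
        field_simp

theorem isProbabilityMeasure_sphericalLaplace (hγ : 0 < γ) :
    IsProbabilityMeasure (sphericalLaplace ι γ) := by
  have hint := integrable_exp_neg_mul_norm (volume : Measure (EuclideanSpace ℝ ι)) hγ
  have htop := ((hasFiniteIntegral_iff_ofReal (ae_of_all _ fun b => (Real.exp_pos _).le)).1
    hint.2).ne
  have h0 : ∫⁻ b : EuclideanSpace ℝ ι, ENNReal.ofReal (Real.exp (-γ * ‖b‖)) ≠ 0 := by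
    rw [← ofReal_integral_eq_lintegral_ofReal hint (ae_of_all _ fun b => (Real.exp_pos _).le)]
    simpa using integral_exp_pos hint
  refine ⟨?_⟩
  rw [sphericalLaplace, Measure.smul_apply, withDensity_apply _ MeasurableSet.univ,
    Measure.restrict_univ, smul_eq_mul, ENNReal.inv_mul_cancel h0 htop]

variable {S T S₁ S₂ T₁ T₂ : EuclideanSpace ℝ ι → EuclideanSpace ℝ ι}
  {T' T₁' T₂' : EuclideanSpace ℝ ι → EuclideanSpace ℝ ι →L[ℝ] EuclideanSpace ℝ ι}

theorem map_sphericalLaplace_eq_of_inverse (γ : ℝ) (hST : Function.LeftInverse S T)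
    (hTS : Function.RightInverse S T) (hT : ∀ θ, HasFDerivAt T (T' θ) θ) :
    (sphericalLaplace ι γ).map S =
      (∫⁻ b : EuclideanSpace ℝ ι, ENNReal.ofReal (Real.exp (-γ * ‖b‖)))⁻¹ •
        volume.withDensity fun θ => ENNReal.ofReal (|(T' θ).det| * Real.exp (-γ * ‖T θ‖)) := by
  simp_rw [ENNReal.ofReal_mul (abs_nonneg _)]
  rw [sphericalLaplace, Measure.map_smul, map_withDensity_eq_of_inverse volume hST hTS hT]

theorem map_sphericalLaplace_le_of_inverse {K : ℝ} (hK : 0 ≤ K)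
    (hST₁ : Function.LeftInverse S₁ T₁) (hTS₁ : Function.RightInverse S₁ T₁)
    (hT₁ : ∀ θ, HasFDerivAt T₁ (T₁' θ) θ)
    (hST₂ : Function.LeftInverse S₂ T₂) (hTS₂ : Function.RightInverse S₂ T₂)
    (hT₂ : ∀ θ, HasFDerivAt T₂ (T₂' θ) θ)
    (hle : ∀ θ, |(T₁' θ).det| * Real.exp (-γ * ‖T₁ θ‖) ≤
      K * (|(T₂' θ).det| * Real.exp (-γ * ‖T₂ θ‖))) :
    (sphericalLaplace ι γ).map S₁ ≤ ENNReal.ofReal K • (sphericalLaplace ι γ).map S₂ := by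
  rw [map_sphericalLaplace_eq_of_inverse γ hST₁ hTS₁ hT₁,
    map_sphericalLaplace_eq_of_inverse γ hST₂ hTS₂ hT₂, smul_comm,
    ← withDensity_smul' _ _ ENNReal.ofReal_ne_top]
  gcongr
  refine withDensity_mono (ae_of_all _ fun θ => ?_)
  rw [Pi.smul_apply, smul_eq_mul, ← ENNReal.ofReal_mul hK]
  exact ENNReal.ofReal_le_ofReal (hle θ)

theorem map_add_sphericalLaplace_le (hγ : 0 ≤ γ) (v : EuclideanSpace ℝ ι) :
    (sphericalLaplace ι γ).map (· + v) ≤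
      ENNReal.ofReal (Real.exp (γ * ‖v‖)) • sphericalLaplace ι γ := by
  conv_rhs => rw [← Measure.map_id (μ := sphericalLaplace ι γ)]
  refine map_sphericalLaplace_le_of_inverse (Real.exp_pos _).le
    (T₁ := (· - v)) (fun θ => sub_add_cancel θ v) (fun θ => add_sub_cancel_right θ v)
    (fun θ => (hasFDerivAt_id θ).sub_const v) (T₂ := fun θ => θ) (fun _ => rfl)
    (fun _ => rfl) hasFDerivAt_id fun θ => ?_
  rw [mul_left_comm, ← Real.exp_add]
  gcongr
  linarith [mul_le_mul_of_nonneg_left (norm_le_norm_sub_add θ v) hγ]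

theorem map_smul_sphericalLaplace (hγ : 0 < γ) {s : ℝ} (hs : 0 < s) :
    (sphericalLaplace ι γ).map (s • ·) = sphericalLaplace ι (γ / s) := by
  have := isProbabilityMeasure_sphericalLaplace (ι := ι) hγ
  have hprob : IsProbabilityMeasure ((sphericalLaplace ι γ).map (s • ·)) :=
    Measure.isProbabilityMeasure_map (by fun_prop)
  obtain ⟨k, hk⟩ : ∃ k : ℝ≥0∞, (sphericalLaplace ι γ).map (s • ·) =
      k • volume.withDensity fun b => ENNReal.ofReal (Real.exp (-(γ / s) * ‖b‖)) := by
    have hexp (θ : EuclideanSpace ℝ ι) : -γ * ‖s⁻¹ • θ‖ = -(γ / s) * ‖θ‖ := by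
      rw [norm_smul, Real.norm_of_nonneg (inv_pos.2 hs).le]
      ring
    rw [map_sphericalLaplace_eq_of_inverse γ (T := (s⁻¹ • ·)) (smul_inv_smul₀ hs.ne')
      (inv_smul_smul₀ hs.ne') fun θ => (hasFDerivAt_id θ).const_smul s⁻¹]
    simp_rw [ENNReal.ofReal_mul (abs_nonneg _), hexp]
    exact ⟨_, (congrArg _ (withDensity_smul _ (by fun_prop))).trans (smul_smul _ _ _)⟩
  have hone := hprob.measure_univ
  rw [hk, Measure.smul_apply, withDensity_apply _ MeasurableSet.univ, Measure.restrict_univ,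
    smul_eq_mul] at hone
  rw [hk, ENNReal.eq_inv_of_mul_eq_one_left hone, sphericalLaplace]

end SphericalLaplace

section ProductDensity

variable {ι : Type*} [Fintype ι] {X : ι → Type*} [∀ i, MeasurableSpace (X i)]
  (μ : ∀ i, Measure (X i)) [∀ i, IsProbabilityMeasure (μ i)] {h : ∀ i, X i → ℝ≥0∞}

theorem lintegral_pi_prod_eq (hh : ∀ i, Measurable (h i)) :
    ∫⁻ x, ∏ i, h i (x i) ∂Measure.pi μ = ∏ i, ∫⁻ x, h i x ∂μ i := by
  rw [lintegral_prod_eq_prod_lintegral_of_indepFun Finset.univ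
    (fun i (x : ∀ i, X i) => h i (x i)) (iIndepFun_pi fun i => (hh i).aemeasurable)
    fun i => (hh i).comp (measurable_pi_apply i)]
  refine Finset.prod_congr rfl fun i _ => ?_
  rw [← (measurePreserving_eval μ i).map_eq, lintegral_map (hh i) (measurable_pi_apply i)]

theorem pi_withDensity_eq (hh : ∀ i, Measurable (h i))
    [∀ i, SigmaFinite ((μ i).withDensity (h i))] :
    Measure.pi (fun i => (μ i).withDensity (h i)) =
      (Measure.pi μ).withDensity fun x => ∏ i, h i (x i) := by
  refine Measure.pi_eq fun s hs => ?_
  have hind : (Set.univ.pi s).indicator (fun x => ∏ i, h i (x i)) =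
      fun x => ∏ i, (s i).indicator (h i) (x i) := by
    ext x
    by_cases hx : ∀ i, x i ∈ s i
    · rw [Set.indicator_of_mem (by simpa using hx)]
      exact Finset.prod_congr rfl fun i _ => (Set.indicator_of_mem (hx i) _).symm
    · rw [Set.indicator_of_notMem (by simpa using hx)]
      obtain ⟨i, hi⟩ := not_forall.1 hx
      exact (Finset.prod_eq_zero (Finset.mem_univ i) (Set.indicator_of_notMem hi _)).symm
  rw [withDensity_apply _ (MeasurableSet.univ_pi hs),
    ← lintegral_indicator (MeasurableSet.univ_pi hs), hind,
    lintegral_pi_prod_eq μ fun i => (hh i).indicator (hs i)]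
  refine Finset.prod_congr rfl fun i _ => ?_
  rw [withDensity_apply _ (hs i), lintegral_indicator (hs i)]

theorem holderDom_pi_withDensity {p q : ℝ} (hpq : p.HolderConjugate q)
    (hh : ∀ i, Measurable (h i)) [∀ i, SigmaFinite ((μ i).withDensity (h i))] :
    HolderDom q ((∏ i, ∫⁻ x, h i x ^ p ∂μ i) ^ (1 / p))
      (Measure.pi fun i => (μ i).withDensity (h i)) (Measure.pi μ) := by
  have hdom := HolderDom.withDensity hpq (Measure.pi μ) (Z := fun x => ∏ i, h i (x i))
    (by fun_prop)
  simp_rw [← ENNReal.prod_rpow_of_nonneg hpq.nonneg] at hdom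
  rwa [lintegral_pi_prod_eq μ fun i => (hh i).pow_const p, ← pi_withDensity_eq μ hh] at hdom

end ProductDensity

section Gaussian

variable {v : ℝ≥0}

theorem gaussianReal_eq_withDensity (hv : v ≠ 0) (m : ℝ) :
    gaussianReal m v = (gaussianReal 0 v).withDensity fun x =>
      ENNReal.ofReal (Real.exp (m * x / v - m ^ 2 / (2 * v))) := by
  have hv' : (v : ℝ) ≠ 0 := by exact_mod_cast hv
  rw [gaussianReal_of_var_ne_zero _ hv, gaussianReal_of_var_ne_zero _ hv,
    ← withDensity_mul _ (measurable_gaussianPDF _ _) (by fun_prop)]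
  congr 1
  ext x
  simp only [Pi.mul_apply, gaussianPDF, gaussianPDFReal]
  rw [← ENNReal.ofReal_mul (by positivity), mul_assoc (_⁻¹), ← Real.exp_add]
  congr 3
  field_simp
  ring

theorem lintegral_gaussianReal_shift_rpow (hv : v ≠ 0) (m a : ℝ) :
    ∫⁻ x, ENNReal.ofReal (Real.exp (m * x / v - m ^ 2 / (2 * v))) ^ a ∂gaussianReal 0 v =
      ENNReal.ofReal (Real.exp (a * (a - 1) * m ^ 2 / (2 * v))) := by
  have hv' : (v : ℝ) ≠ 0 := by exact_mod_cast hv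
  have hpow (x : ℝ) : ENNReal.ofReal (Real.exp (m * x / v - m ^ 2 / (2 * v))) ^ a =
      ENNReal.ofReal (Real.exp (-(a * m ^ 2 / (2 * v))) * Real.exp (a * m / v * x)) := by
    rw [ENNReal.ofReal_rpow_of_pos (Real.exp_pos _), ← Real.exp_mul, ← Real.exp_add]
    ring_nf
  have hint := (integrable_exp_mul_gaussianReal (μ := 0) (v := v) (a * m / v)).const_mul
    (Real.exp (-(a * m ^ 2 / (2 * v))))
  have hmgf := congrFun (mgf_id_gaussianReal (μ := 0) (v := v)) (a * m / v)
  simp only [mgf, id] at hmgf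
  simp_rw [hpow]
  rw [← ofReal_integral_eq_lintegral_ofReal hint (ae_of_all _ fun x => by positivity),
    integral_const_mul, hmgf, ← Real.exp_add]
  congr 2
  field_simp
  ring

theorem holderDom_pi_gaussianReal_map_add {ι : Type*} [Fintype ι] (hv : v ≠ 0) {a q : ℝ}
    (haq : a.HolderConjugate q) (m : ι → ℝ) :
    HolderDom q (ENNReal.ofReal (Real.exp ((a - 1) * (∑ i, m i ^ 2) / (2 * v))))
      ((Measure.pi fun _ : ι => gaussianReal 0 v).map (· + m))
      (Measure.pi fun _ : ι => gaussianReal 0 v) := by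
  let h (i : ι) (x : ℝ) : ℝ≥0∞ := ENNReal.ofReal (Real.exp (m i * x / v - m i ^ 2 / (2 * v)))
  have hshift (i : ι) :
      (gaussianReal 0 v).map (· + m i) = (gaussianReal 0 v).withDensity (h i) := by
    rw [gaussianReal_map_add_const, zero_add, gaussianReal_eq_withDensity hv (m i)]
  have hσ (i : ι) : SigmaFinite ((gaussianReal 0 v).map (· + m i)) := by
    rw [gaussianReal_map_add_const]
    infer_instance
  have hσ' (i : ι) : SigmaFinite ((gaussianReal 0 v).withDensity (h i)) := hshift i ▸ hσ i
  have hpi : (Measure.pi fun _ : ι => gaussianReal 0 v).map (· + m) =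
      Measure.pi fun i => (gaussianReal 0 v).withDensity (h i) := by
    simp_rw [← hshift]
    exact Measure.pi_map_pi (f := fun i x => x + m i) fun i => by fun_prop
  rw [hpi]
  refine (holderDom_pi_withDensity (fun _ => gaussianReal 0 v) haq fun i => by fun_prop).mono
    (le_of_eq ?_)
  have ha := haq.ne_zero
  simp_rw [h, lintegral_gaussianReal_shift_rpow hv]
  rw [← ENNReal.ofReal_prod_of_nonneg fun i _ => (Real.exp_pos _).le, ← Real.exp_sum,
    ENNReal.ofReal_rpow_of_pos (Real.exp_pos _), ← Real.exp_mul, ← Finset.sum_div,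
    ← Finset.mul_sum]
  congr 2
  field_simp

end Gaussian

section NoiseKernel

variable {α β γ : Type*} [MeasurableSpace α] [MeasurableSpace β] [MeasurableSpace γ]
  {μ : Measure β} {F : α × β → γ}

/-- The randomized map `a ↦ F (a, b)` with noise `b` drawn from `μ`, as a Markov kernel. Like
`Kernel.map`, it is the zero kernel if `F` is not measurable. -/
noncomputable def noiseKernel (μ : Measure β) (F : α × β → γ) : Kernel α γ :=
  (Kernel.id ×ₖ Kernel.const α μ).map F

theorem noiseKernel_apply [SFinite μ] (hF : Measurable F) (a : α) :
    noiseKernel μ F a = μ.map fun b => F (a, b) := by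
  rw [noiseKernel, Kernel.map_apply _ hF, Kernel.prod_apply, Kernel.id_apply, Kernel.const_apply,
    Measure.dirac_prod, Measure.map_map hF measurable_prodMk_left]
  rfl

theorem isMarkovKernel_noiseKernel [IsProbabilityMeasure μ] (hF : Measurable F) :
    IsMarkovKernel (noiseKernel (α := α) μ F) :=
  Kernel.IsMarkovKernel.map _ hF

end NoiseKernel

section MatrixNoise

variable {d : ℕ} {mode : Mode} {φ : ℝ}

theorem isProbabilityMeasure_matrixNoise (mode : Mode) (s : ℝ≥0) (hφ : 0 < φ) :
    IsProbabilityMeasure (matrixNoise d mode s φ) := by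
  cases mode with
  | pureDP =>
    simp only [matrixNoise]
    split_ifs with h
    · infer_instance
    · exact isProbabilityMeasure_sphericalLaplace (by positivity)
  | zCDP => exact Measure.isProbabilityMeasure_map (by fun_prop)

theorem pi_gaussianReal_map_const_mul {ι : Type*} [Fintype ι] (v s : ℝ≥0) :
    (Measure.pi fun _ : ι => gaussianReal 0 v).map (fun x i => (s : ℝ) * x i) =
      Measure.pi fun _ : ι => gaussianReal 0 (s ^ 2 * v) := by
  have hscale : (gaussianReal 0 v).map ((s : ℝ) * ·) = gaussianReal 0 (s ^ 2 * v) := by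
    rw [gaussianReal_map_const_mul, mul_zero]
    rfl
  have : SigmaFinite ((gaussianReal 0 v).map ((s : ℝ) * ·)) := by
    rw [hscale]
    infer_instance
  rw [← hscale]
  exact Measure.pi_map_pi (f := fun _ x => (s : ℝ) * x) fun _ => by fun_prop

theorem matrixNoise_eq_map_smul (mode : Mode) (s : ℝ≥0) (hφ : 0 < φ) :
    matrixNoise d mode s φ = (matrixNoise d mode 1 φ).map ((s : ℝ) • ·) := by
  cases mode with
  | pureDP =>
    simp only [matrixNoise, one_ne_zero, if_false, NNReal.coe_one, div_one]
    split_ifs with hs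
    · have := isProbabilityMeasure_sphericalLaplace (ι := Fin d × Fin d) hφ
      simp [hs, Measure.map_const]
    · exact (map_smul_sphericalLaplace hφ (by positivity)).symm
  | zCDP =>
    simp only [matrixNoise]
    rw [← mul_one_div, ← pi_gaussianReal_map_const_mul, Measure.map_map (by fun_prop)
      (by fun_prop), Measure.map_map (by fun_prop) (by fun_prop), one_pow]
    rfl

theorem map_add_matrixNoise_pureDP_le (hφ : 0 ≤ φ) {v : EuclideanSpace ℝ (Fin d × Fin d)}
    (hv : ‖v‖ ≤ 1) : (matrixNoise d .pureDP 1 φ).map (· + v) ≤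
      ENNReal.ofReal (Real.exp φ) • matrixNoise d .pureDP 1 φ := by
  simp only [matrixNoise, one_ne_zero, if_false, NNReal.coe_one, div_one]
  refine (map_add_sphericalLaplace_le hφ v).trans ?_
  gcongr
  exact mul_le_of_le_one_right hφ hv

theorem holderDom_map_add_matrixNoise (mode : Mode) (hφ : 0 < φ)
    {v : EuclideanSpace ℝ (Fin d × Fin d)} (hv : ‖v‖ ≤ 1) {a q : ℝ} (haq : a.HolderConjugate q) :
    HolderDom q (ENNReal.ofReal (Real.exp (φ * (a - 1))))
      ((matrixNoise d mode 1 φ).map (· + v)) (matrixNoise d mode 1 φ) := by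
  have ha : 0 < a - 1 := sub_pos.2 haq.lt
  cases mode with
  | pureDP =>
    have := isProbabilityMeasure_matrixNoise (d := d) .pureDP 1 hφ
    have : IsProbabilityMeasure ((matrixNoise d .pureDP 1 φ).map (· + v)) :=
      Measure.isProbabilityMeasure_map (by fun_prop)
    have hq : 1 / q ≤ a - 1 := by
      rw [one_div, ← haq.one_sub_inv, ← sub_nonneg,
        show a - 1 - (1 - a⁻¹) = (a - 1) ^ 2 / a by have := haq.ne_zero; field_simp]
      exact div_nonneg (sq_nonneg _) haq.nonneg
    refine (HolderDom.of_one haq.symm.lt.le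
      (holderDom_one_iff.2 (map_add_matrixNoise_pureDP_le hφ.le hv))).mono ?_
    rw [ENNReal.ofReal_rpow_of_pos (Real.exp_pos _), ← Real.exp_mul]
    gcongr
  | zCDP =>
    have : φ.toNNReal ≠ 0 := by simpa using hφ
    have hdom := (holderDom_pi_gaussianReal_map_add (v := 1 ^ 2 / (2 * φ.toNNReal))
      (by positivity) haq v.ofLp).map (F := WithLp.toLp 2) (by fun_prop)
    simp only [matrixNoise]
    rw [Measure.map_map (by fun_prop) (by fun_prop)] at hdom ⊢
    refine hdom.mono (ENNReal.ofReal_le_ofReal (Real.exp_le_exp.2 ?_))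
    have hsq : ∑ i, v.ofLp i ^ 2 ≤ 1 := by
      rw [← EuclideanSpace.real_norm_sq_eq]
      exact pow_le_one₀ (norm_nonneg v) hv
    push_cast
    rw [Real.coe_toNNReal _ hφ.le]
    calc (a - 1) * (∑ i, v.ofLp i ^ 2) / (2 * (1 ^ 2 / (2 * φ)))
        ≤ (a - 1) * 1 / (2 * (1 ^ 2 / (2 * φ))) := by gcongr
      _ = φ * (a - 1) := by field_simp

end MatrixNoise

section MatrixFunctions

variable {d : ℕ}

instance instBorelSpaceMatrix : BorelSpace (Matrix (Fin d) (Fin d) ℝ) :=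
  inferInstanceAs (BorelSpace (Fin d → Fin d → ℝ))

theorem measurable_matrix_iff {α : Type*} [MeasurableSpace α]
    {F : α → Matrix (Fin d) (Fin d) ℝ} :
    Measurable F ↔ ∀ i j, Measurable fun a => F a i j :=
  measurable_pi_iff.trans (forall_congr' fun _ => measurable_pi_iff)

theorem clipEigenvalues_eq_cfc (r : ℝ) (A : Matrix (Fin d) (Fin d) ℝ) (hA : A.IsHermitian) :
    clipEigenvalues r A hA = cfc (max · r) A := by
  rw [hA.cfc_eq, Matrix.IsHermitian.cfc, Unitary.conjStarAlgAut_apply]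
  rfl

open scoped Matrix.Norms.L2Operator in
theorem continuous_clipEigenvalues_symPart (r : ℝ) :
    Continuous fun A : Matrix (Fin d) (Fin d) ℝ =>
      clipEigenvalues r (symPart A) (symPart_isHermitian A) := by
  simp only [clipEigenvalues_eq_cfc]
  exact Continuous.cfc_of_mem_nhdsSet _ Filter.univ_mem (by unfold symPart; fun_prop)
    symPart_isHermitian

open scoped Matrix.Norms.L2Operator MatrixOrder in
theorem measurable_matrix_sqrt :
    Measurable (CFC.sqrt : Matrix (Fin d) (Fin d) ℝ → Matrix (Fin d) (Fin d) ℝ) := by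
  have hclosed : IsClosed {A : Matrix (Fin d) (Fin d) ℝ | 0 ≤ A} := by
    simp only [Matrix.nonneg_iff_posSemidef, Matrix.posSemidef_iff_dotProduct_mulVec,
      Matrix.IsHermitian, Set.ofPred_and, Set.ofPred_forall]
    exact (isClosed_eq (by fun_prop) continuous_id).inter
      (isClosed_iInter fun x => isClosed_le continuous_const (by fun_prop))
  refine measurable_of_restrict_of_restrict_compl hclosed.measurableSet ?_ ?_
  · exact (continuousOn_iff_continuous_domRestrict.1 CFC.continuousOn_sqrt).measurable
  · convert (measurable_const : Measurable fun _ => (0 : Matrix (Fin d) (Fin d) ℝ)) with A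
    exact cfcₙ_apply_of_not_predicate _ A.2

theorem measurable_matrix_inv : Measurable fun A : Matrix (Fin d) (Fin d) ℝ => A⁻¹ := by
  have hdet : Measurable fun A : Matrix (Fin d) (Fin d) ℝ => A.det :=
    continuous_id.matrix_det.measurable
  have hadj : Measurable fun A : Matrix (Fin d) (Fin d) ℝ => A.adjugate :=
    continuous_id.matrix_adjugate.measurable
  simp only [Matrix.inv_def, Ring.inverse_eq_inv']
  exact measurable_matrix_iff.2 fun i j => hdet.inv.mul (measurable_matrix_iff.1 hadj i j)

end MatrixFunctions

section PrivSPDMat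

variable {d : ℕ}

/-- The sampling map of `privSPDMat` as a function of the matrix `p.1.1`, the sensitivity `p.1.2`
and the matrix noise `p.2`, which is normalized to have sensitivity `1`. -/
noncomputable def spdSample (c : ℝ)
    (p : (Matrix (Fin d) (Fin d) ℝ × ℝ≥0) × EuclideanSpace ℝ (Fin d × Fin d)) :
    Matrix (Fin d) (Fin d) ℝ :=
  clipEigenvalues (2 * c) (symPart (p.1.1 + toMat ((p.1.2 : ℝ) • p.2))) (symPart_isHermitian _)

theorem measurable_spdSample (c : ℝ) : Measurable (spdSample (d := d) c) := by
  refine (continuous_clipEigenvalues_symPart (2 * c)).measurable.comp (Continuous.measurable ?_)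
  refine continuous_matrix fun i j => ?_
  simp only [toMat, Matrix.add_apply, Matrix.of_apply]
  fun_prop

theorem privSPDMat_eq_map_spdSample (mode : Mode) (M : Matrix (Fin d) (Fin d) ℝ) (s : ℝ≥0)
    {φ : ℝ} (hφ : 0 < φ) (c : ℝ) :
    privSPDMat mode M s φ c = (matrixNoise d mode 1 φ).map fun η => spdSample c ((M, s), η) := by
  rw [privSPDMat, matrixNoise_eq_map_smul mode s hφ, Measure.map_map _ (by fun_prop)]
  · rfl
  · refine (continuous_clipEigenvalues_symPart (2 * c)).measurable.comp (Continuous.measurable ?_)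
    refine continuous_matrix fun i j => ?_
    simp only [toMat, Matrix.add_apply, Matrix.of_apply]
    fun_prop

theorem exists_spdSample_eq_spdSample_add (c : ℝ) {M M' : Matrix (Fin d) (Fin d) ℝ} {s : ℝ≥0}
    (h : ‖toVec M - toVec M'‖ ≤ s) :
    ∃ v : EuclideanSpace ℝ (Fin d × Fin d), ‖v‖ ≤ 1 ∧
      ∀ η, spdSample c ((M, s), η) = spdSample c ((M', s), η + v) := by
  refine ⟨(s : ℝ)⁻¹ • (toVec M - toVec M'), ?_, fun η => ?_⟩
  · rw [norm_smul, norm_inv, Real.norm_of_nonneg s.coe_nonneg]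
    exact inv_mul_le_one_of_le₀ h s.2
  · have hscale : (s : ℝ) • (s : ℝ)⁻¹ • (toVec M - toVec M') = toVec M - toVec M' := by
      rcases eq_or_ne (s : ℝ) 0 with hs | hs
      · simp [norm_le_zero_iff.1 (hs ▸ h)]
      · rw [smul_inv_smul₀ hs]
    have hshift : M + toMat ((s : ℝ) • η) =
        M' + toMat ((s : ℝ) • (η + (s : ℝ)⁻¹ • (toVec M - toVec M'))) := by
      rw [smul_add, hscale]
      ext i j
      simp only [Matrix.add_apply, toMat, toVec, Matrix.of_apply, PiLp.add_apply, PiLp.sub_apply]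
      ring
    simp only [spdSample, clipEigenvalues_eq_cfc, hshift]

theorem privSPDMat_eq_map_map_add (mode : Mode) {M M' : Matrix (Fin d) (Fin d) ℝ} {s : ℝ≥0}
    {φ : ℝ} (hφ : 0 < φ) (c : ℝ) (h : ‖toVec M - toVec M'‖ ≤ s) :
    ∃ v : EuclideanSpace ℝ (Fin d × Fin d), ‖v‖ ≤ 1 ∧
      privSPDMat mode M s φ c = ((matrixNoise d mode 1 φ).map (· + v)).map
        fun η => spdSample c ((M', s), η) := by
  obtain ⟨v, hv, hη⟩ := exists_spdSample_eq_spdSample_add c h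
  refine ⟨v, hv, ?_⟩
  rw [privSPDMat_eq_map_spdSample mode M s hφ, Measure.map_map _ (by fun_prop)]
  · simp only [hη]; rfl
  · exact (measurable_spdSample c).comp measurable_prodMk_left

theorem privSPDMat_pureDP_le {M M' : Matrix (Fin d) (Fin d) ℝ} {s : ℝ≥0} {φ : ℝ} (hφ : 0 < φ)
    (c : ℝ) (h : ‖toVec M - toVec M'‖ ≤ s) :
    privSPDMat .pureDP M s φ c ≤ ENNReal.ofReal (Real.exp φ) • privSPDMat .pureDP M' s φ c := by
  obtain ⟨v, hv, e⟩ := privSPDMat_eq_map_map_add .pureDP hφ c h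
  rw [e, privSPDMat_eq_map_spdSample .pureDP M' s hφ, ← holderDom_one_iff]
  exact (holderDom_one_iff.2 (map_add_matrixNoise_pureDP_le hφ.le hv)).map
    ((measurable_spdSample c).comp measurable_prodMk_left)

theorem holderDom_privSPDMat (mode : Mode) {M M' : Matrix (Fin d) (Fin d) ℝ} {s : ℝ≥0} {φ : ℝ}
    (hφ : 0 < φ) (c : ℝ) (h : ‖toVec M - toVec M'‖ ≤ s) {a q : ℝ} (haq : a.HolderConjugate q) :
    HolderDom q (ENNReal.ofReal (Real.exp (φ * (a - 1))))
      (privSPDMat mode M s φ c) (privSPDMat mode M' s φ c) := by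
  obtain ⟨v, hv, e⟩ := privSPDMat_eq_map_map_add mode hφ c h
  rw [e, privSPDMat_eq_map_spdSample mode M' s hφ]
  exact (holderDom_map_add_matrixNoise mode hφ hv haq).map
    ((measurable_spdSample c).comp measurable_prodMk_left)

theorem norm_toVec_sub_le_of_l2Sensitivity_le {n : ℕ} {F : Database d n → Matrix (Fin d) (Fin d) ℝ}
    {s : ℝ≥0} (h : l2Sensitivity F ≤ s) {D D' : Database d n} (hD : Neighbor D D') :
    ‖toVec (F D) - toVec (F D')‖ ≤ s := by
  have hle : ‖toVec (F D) - toVec (F D')‖ₑ ≤ s :=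
    (le_iSup₂_of_le D D' (le_iSup (fun _ => _) hD)).trans h
  rw [enorm_eq_nnnorm] at hle
  exact_mod_cast hle

end PrivSPDMat

section RankOne

variable {ι : Type*} [DecidableEq ι] {A B : Matrix ι ι ℝ} {a k : ℝ}

theorem posDef_add_smul_one (hB : B.PosSemidef) (hk : 0 < k) : (B + k • 1).PosDef :=
  Matrix.PosDef.posSemidef_add hB (Matrix.PosDef.one.smul hk)

variable [Fintype ι]

theorem det_add_smul_vecMulVec (hA : IsUnit A.det) (a : ℝ) (x : ι → ℝ) :
    (A + a • Matrix.vecMulVec x x).det = A.det * (1 + a * (x ⬝ᵥ A⁻¹ *ᵥ x)) := by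
  rw [← Matrix.smul_vecMulVec, Matrix.vecMulVec_eq Unit,
    Matrix.det_add_replicateCol_mul_replicateRow hA, Matrix.det_unique (n := Unit),
    Matrix.add_apply,
    Matrix.one_apply_eq, Matrix.mul_assoc, ← Matrix.replicateCol_mulVec,
    Matrix.replicateRow_mul_replicateCol_apply, Matrix.mulVec_smul, dotProduct_smul, smul_eq_mul]

theorem det_le_det_add_smul_vecMulVec (hA : A.PosDef) (ha : 0 ≤ a) (x : ι → ℝ) :
    A.det ≤ (A + a • Matrix.vecMulVec x x).det := by
  have hx : 0 ≤ x ⬝ᵥ A⁻¹ *ᵥ x := by simpa using hA.inv.posSemidef.dotProduct_mulVec_nonneg x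
  rw [det_add_smul_vecMulVec hA.det_pos.ne'.isUnit]
  exact le_mul_of_one_le_right hA.det_pos.le (le_add_of_nonneg_right (mul_nonneg ha hx))

theorem dotProduct_inv_add_smul_one_mulVec_le (hB : B.PosSemidef) (hk : 0 < k) (x : ι → ℝ) :
    x ⬝ᵥ (B + k • 1)⁻¹ *ᵥ x ≤ x ⬝ᵥ x / k := by
  have hunit : IsUnit (B + k • 1).det := (posDef_add_smul_one hB hk).det_pos.ne'.isUnit
  set z := (B + k • 1)⁻¹ *ᵥ x with hz
  have hx : B *ᵥ z + k • z = x := by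
    rw [← Matrix.one_mulVec (k • z), Matrix.mulVec_smul, ← Matrix.smul_mulVec, ← Matrix.add_mulVec,
      hz, Matrix.mulVec_mulVec, Matrix.mul_nonsing_inv _ hunit,
      Matrix.one_mulVec]
  have hxz : x ⬝ᵥ z = z ⬝ᵥ B *ᵥ z + k * (z ⬝ᵥ z) := by
    rw [dotProduct_comm]
    nth_rw 1 [← hx]
    rw [dotProduct_add, dotProduct_smul, smul_eq_mul]
  have hzBz : 0 ≤ z ⬝ᵥ B *ᵥ z := by simpa using hB.dotProduct_mulVec_nonneg z
  have hsq : 0 ≤ (x - k • z) ⬝ᵥ (x - k • z) := by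
    simpa using dotProduct_star_self_nonneg (x - k • z)
  simp only [sub_dotProduct, dotProduct_sub, smul_dotProduct, dotProduct_smul, smul_eq_mul,
    dotProduct_comm z x] at hsq
  rw [le_div_iff₀ hk]
  nlinarith

theorem det_add_smul_vecMulVec_le (hB : B.PosSemidef) (hk : 0 < k) (ha : 0 ≤ a) (x : ι → ℝ) :
    (B + k • 1 + a • Matrix.vecMulVec x x).det ≤
      (1 + a * (x ⬝ᵥ x / k)) * (B + k • 1).det := by
  have hdet := (posDef_add_smul_one hB hk).det_pos
  rw [det_add_smul_vecMulVec hdet.ne'.isUnit, mul_comm]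
  gcongr
  exact dotProduct_inv_add_smul_one_mulVec_le hB hk x

end RankOne

theorem add_deriv_mul_sub_le_of_convexOn {f : ℝ → ℝ} (hconv : ConvexOn ℝ Set.univ f) {x : ℝ}
    (hx : DifferentiableAt ℝ f x) (y : ℝ) : f x + deriv f x * (y - x) ≤ f y := by
  rcases lt_trichotomy x y with h | rfl | h
  · have hslope := hconv.deriv_le_slope trivial trivial h hx
    rw [slope_def_field, le_div_iff₀ (sub_pos.2 h)] at hslope
    linarith
  · simp
  · have hslope := hconv.slope_le_deriv trivial trivial h hx
    rw [slope_def_field, div_le_iff₀ (sub_pos.2 h)] at hslope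
    linarith

section Loss

variable {d n : ℕ} {f : ℝ → ℝ}

theorem Record.y_mul_self (r : Record d) : r.y * r.y = 1 := by
  rcases r.y_mem with h | h <;> simp [h]

theorem Record.abs_y (r : Record d) : |r.y| = 1 := by
  rcases r.y_mem with h | h <;> simp [h]

theorem Record.dotProduct_self_le (r : Record d) : r.x.ofLp ⬝ᵥ r.x.ofLp ≤ 1 := by
  have h : r.x.ofLp ⬝ᵥ r.x.ofLp = ‖r.x‖ ^ 2 := by
    rw [EuclideanSpace.real_norm_sq_eq, dotProduct]
    exact Finset.sum_congr rfl fun i _ => (sq _).symm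
  rw [h]
  exact pow_le_one₀ (norm_nonneg _) r.norm_x_le

theorem Neighbor.symm {D D' : Database d n} (h : Neighbor D D') : Neighbor D' D :=
  h.imp fun _ hi j hj => (hi j hj).symm

theorem Neighbor.exists_sum_eq_sum_erase_add {M : Type*} [AddCommMonoid M] {D D' : Database d n}
    (h : Neighbor D D') (F : Record d → M) :
    ∃ i, ∑ j, F (D' j) = ∑ j ∈ Finset.univ.erase i, F (D j) + F (D' i) := by
  obtain ⟨i, hi⟩ := h
  refine ⟨i, ?_⟩
  rw [← Finset.sum_erase_add _ _ (Finset.mem_univ i)]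
  congr 1
  exact Finset.sum_congr rfl fun j hj => by rw [hi j (Finset.ne_of_mem_erase hj)]

theorem hasFDerivAt_margin (r : Record d) (θ : EuclideanSpace ℝ (Fin d)) :
    HasFDerivAt (fun θ => r.y * inner ℝ θ r.x) (r.y • innerSL ℝ r.x) θ := by
  simpa only [innerSL_apply_apply, real_inner_comm] using
    ((innerSL ℝ r.x).hasFDerivAt (x := θ)).const_mul r.y

theorem hasGradientAt_loss (hf : Differentiable ℝ f) (r : Record d)
    (θ : EuclideanSpace ℝ (Fin d)) :
    HasGradientAt (loss f r) ((deriv f (r.y * inner ℝ θ r.x) * r.y) • r.x) θ := by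
  rw [hasGradientAt_iff_hasFDerivAt, map_smul, mul_smul]
  exact (hf _).hasDerivAt.comp_hasFDerivAt θ (hasFDerivAt_margin r θ)

theorem gradient_loss (hf : Differentiable ℝ f) (r : Record d) (θ : EuclideanSpace ℝ (Fin d)) :
    gradient (loss f r) θ = (deriv f (r.y * inner ℝ θ r.x) * r.y) • r.x :=
  (hasGradientAt_loss hf r θ).gradient

theorem norm_gradient_loss_le (hf : Differentiable ℝ f) (hf1 : ∀ z, |deriv f z| ≤ 1)
    (r : Record d) (θ : EuclideanSpace ℝ (Fin d)) : ‖gradient (loss f r) θ‖ ≤ 1 := by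
  rw [gradient_loss hf, norm_smul, Real.norm_eq_abs, abs_mul, r.abs_y, mul_one]
  exact mul_le_one₀ (hf1 _) (norm_nonneg _) r.norm_x_le

theorem loss_add_inner_gradient_le (hf : Differentiable ℝ f) (hm : Monotone (deriv f))
    (r : Record d) (θ₀ θ : EuclideanSpace ℝ (Fin d)) :
    loss f r θ₀ + inner ℝ (gradient (loss f r) θ₀) (θ - θ₀) ≤ loss f r θ := by
  have hinner : inner ℝ (gradient (loss f r) θ₀) (θ - θ₀) =
      deriv f (r.y * inner ℝ θ₀ r.x) * (r.y * inner ℝ θ r.x - r.y * inner ℝ θ₀ r.x) := by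
    rw [gradient_loss hf, real_inner_smul_left, inner_sub_right, real_inner_comm θ,
      real_inner_comm θ₀]
    ring
  rw [hinner]
  exact add_deriv_mul_sub_le_of_convexOn (hm.convexOn_univ_of_deriv hf) (hf _) _

theorem inner_gradient_loss_sub_nonneg (hf : Differentiable ℝ f) (hm : Monotone (deriv f))
    (r : Record d) (θ θ' : EuclideanSpace ℝ (Fin d)) :
    0 ≤ inner ℝ (gradient (loss f r) θ - gradient (loss f r) θ') (θ - θ') := by
  set u := r.y * inner ℝ θ r.x with hu
  set u' := r.y * inner ℝ θ' r.x with hu'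
  have hinner : inner ℝ (gradient (loss f r) θ - gradient (loss f r) θ') (θ - θ') =
      (deriv f u - deriv f u') * (u - u') := by
    simp only [gradient_loss hf, hu, hu', inner_sub_left, inner_sub_right, real_inner_smul_left,
      real_inner_comm r.x]
    ring
  rw [hinner]
  rcases le_total u u' with h | h
  · exact mul_nonneg_of_nonpos_of_nonpos (sub_nonpos.2 (hm h)) (sub_nonpos.2 h)
  · exact mul_nonneg (sub_nonneg.2 (hm h)) (sub_nonneg.2 h)

theorem hasFDerivAt_gradient_loss (hf : Differentiable ℝ f) (hf' : Differentiable ℝ (deriv f))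
    (r : Record d) (θ : EuclideanSpace ℝ (Fin d)) :
    HasFDerivAt (gradient (loss f r))
      (deriv (deriv f) (r.y * inner ℝ θ r.x) • (innerSL ℝ r.x).smulRight r.x) θ := by
  rw [funext (gradient_loss hf r)]
  have h := (hf' (r.y * inner ℝ θ r.x)).hasDerivAt.comp_hasFDerivAt θ (hasFDerivAt_margin r θ)
  refine ((h.mul_const r.y).smul_const r.x).congr_fderiv ?_
  ext1 v
  simp only [ContinuousLinearMap.smulRight_apply, _root_.smul_apply, smul_eq_mul,
    innerSL_apply_apply, smul_smul]
  congr 1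
  linear_combination (deriv (deriv f) (r.y * inner ℝ θ r.x) * inner ℝ r.x v) * r.y_mul_self

theorem hessian_loss (hf : Differentiable ℝ f) (hf' : Differentiable ℝ (deriv f))
    (r : Record d) (θ : EuclideanSpace ℝ (Fin d)) :
    hessian (loss f r) θ =
      deriv (deriv f) (r.y * inner ℝ θ r.x) • Matrix.vecMulVec r.x.ofLp r.x.ofLp := by
  ext i j
  have hpartial (w : EuclideanSpace ℝ (Fin d)) :
      fderiv ℝ (loss f r) w (EuclideanSpace.single j 1) = gradient (loss f r) w j := by
    rw [gradient_loss hf, (hasGradientAt_loss hf r w).hasFDerivAt.fderiv,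
      InnerProductSpace.toDual_apply_apply, EuclideanSpace.inner_single_right]
    simp
  have hderiv : HasFDerivAt (fun w => gradient (loss f r) w j) _ θ :=
    (EuclideanSpace.proj (𝕜 := ℝ) j).hasFDerivAt.comp θ (hasFDerivAt_gradient_loss hf hf' r θ)
  rw [hessian, Matrix.of_apply, funext hpartial, hderiv.fderiv]
  simp [Matrix.vecMulVec_apply, EuclideanSpace.inner_single_right]

theorem toEuclideanCLM_hessian_loss (hf : Differentiable ℝ f) (hf' : Differentiable ℝ (deriv f))
    (r : Record d) (θ : EuclideanSpace ℝ (Fin d)) :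
    Matrix.toEuclideanCLM (𝕜 := ℝ) (hessian (loss f r) θ) =
      deriv (deriv f) (r.y * inner ℝ θ r.x) • (innerSL ℝ r.x).smulRight r.x := by
  ext v i
  simp [hessian_loss hf hf', Matrix.vecMulVec_mulVec, EuclideanSpace.inner_eq_star_dotProduct,
    dotProduct_comm, mul_comm]

theorem posSemidef_hessian_loss (hf : Differentiable ℝ f) (hf' : Differentiable ℝ (deriv f))
    (hm : Monotone (deriv f)) (r : Record d) (θ : EuclideanSpace ℝ (Fin d)) :
    (hessian (loss f r) θ).PosSemidef := by
  rw [hessian_loss hf hf']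
  exact .smul (by simpa using Matrix.posSemidef_vecMulVec_self_star r.x.ofLp) hm.deriv_nonneg

end Loss

theorem abs_det_neg_smul_toEuclideanCLM {d : ℕ} {k : ℝ} (hk : 0 ≤ k)
    (A : Matrix (Fin d) (Fin d) ℝ) :
    |(-(k • Matrix.toEuclideanCLM (𝕜 := ℝ) A)).det| = k ^ d * |A.det| := by
  rw [ContinuousLinearMap.det, ContinuousLinearMap.toLinearMap_neg,
    ContinuousLinearMap.toLinearMap_smul, ← neg_smul, LinearMap.det_smul,
    finrank_euclideanSpace_fin, Matrix.coe_toEuclideanCLM_eq_toEuclideanLin, Matrix.toEuclideanLin,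
    LinearMap.det_toLpLin, abs_mul, abs_pow, abs_neg, abs_of_nonneg hk]

section CriticalNoise

variable {d n : ℕ} {f : ℝ → ℝ} {c : ℝ}

/-- The inverse of objective perturbation: the noise vector `β` for which `θ` is the critical point
of the perturbed objective. -/
noncomputable def critNoise (f : ℝ → ℝ) (c : ℝ) (D : Database d n)
    (θ : EuclideanSpace ℝ (Fin d)) : EuclideanSpace ℝ (Fin d) :=
  -(∑ i, gradient (loss f (D i)) θ + (2 * n * c) • θ)

theorem hasFDerivAt_critNoise (hf : Differentiable ℝ f) (hf' : Differentiable ℝ (deriv f))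
    (hn : 0 < n) (c : ℝ) (D : Database d n) (θ : EuclideanSpace ℝ (Fin d)) :
    HasFDerivAt (critNoise f c D)
      (-((n : ℝ) • Matrix.toEuclideanCLM (𝕜 := ℝ) (hessianMat f c θ D))) θ := by
  have hn' : (n : ℝ) ≠ 0 := by positivity
  refine ((HasFDerivAt.fun_sum fun i _ => hasFDerivAt_gradient_loss hf hf' (D i) θ).add
    ((hasFDerivAt_id θ).const_smul (2 * n * c : ℝ))).neg.congr_fderiv ?_
  simp only [hessianMat, map_add, map_smul, map_sum, map_one, toEuclideanCLM_hessian_loss hf hf',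
    smul_add, smul_smul, mul_one_div_cancel hn', one_smul, mul_left_comm (n : ℝ) 2 c, mul_assoc]
  rfl

theorem mul_norm_sq_le_inner_critNoise_sub (hf : Differentiable ℝ f) (hm : Monotone (deriv f))
    (c : ℝ) (D : Database d n) (θ θ' : EuclideanSpace ℝ (Fin d)) :
    2 * n * c * ‖θ - θ'‖ ^ 2 ≤ inner ℝ (critNoise f c D θ' - critNoise f c D θ) (θ - θ') := by
  have hsum : critNoise f c D θ' - critNoise f c D θ =
      ∑ i, (gradient (loss f (D i)) θ - gradient (loss f (D i)) θ') +
        (2 * n * c) • (θ - θ') := by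
    rw [Finset.sum_sub_distrib, smul_sub, critNoise, critNoise]
    abel
  rw [hsum, inner_add_left, sum_inner, real_inner_smul_left, real_inner_self_eq_norm_sq]
  exact le_add_of_nonneg_left
    (Finset.sum_nonneg fun i _ => inner_gradient_loss_sub_nonneg hf hm (D i) θ θ')

theorem critNoise_injective (hf : Differentiable ℝ f) (hm : Monotone (deriv f)) (hn : 0 < n)
    (hc : 0 < c) (D : Database d n) : Function.Injective (critNoise f c D) := by
  intro θ θ' h
  have hle := mul_norm_sq_le_inner_critNoise_sub hf hm c D θ θ'
  rw [h, sub_self, inner_zero_left] at hle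
  have hzero : ‖θ - θ'‖ ^ 2 ≤ 0 := nonpos_of_mul_nonpos_right hle (by positivity)
  exact sub_eq_zero.1 (norm_eq_zero.1 (pow_eq_zero_iff two_ne_zero |>.1
    (le_antisymm hzero (sq_nonneg _))))

theorem hasGradientAt_objective (hf : Differentiable ℝ f) (c : ℝ) (D : Database d n)
    (β θ : EuclideanSpace ℝ (Fin d)) :
    HasGradientAt (objective f c D β) ((1 / n : ℝ) • (β - critNoise f c D θ)) θ := by
  have hloss (i) : HasFDerivAt (loss f (D i)) _ θ :=
    (hasGradientAt_loss hf (D i) θ).differentiableAt.hasGradientAt.hasFDerivAt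
  have hsq := (hasStrictFDerivAt_norm_sq θ).hasFDerivAt.const_mul c
  have hβ : HasFDerivAt (fun θ => inner ℝ β θ) (innerSL ℝ β) θ := (innerSL ℝ β).hasFDerivAt
  rw [hasGradientAt_iff_hasFDerivAt]
  refine (((HasFDerivAt.fun_sum fun i (_ : i ∈ Finset.univ) => (hloss i).add hsq).const_mul
    (1 / n : ℝ)).add (hβ.const_mul (1 / n : ℝ))).congr_fderiv ?_
  ext1 v
  simp only [critNoise, Finset.sum_add_distrib, Finset.sum_const, Finset.card_univ,
    Fintype.card_fin, _root_.add_apply, _root_.smul_apply, _root_.sum_apply, innerSL_apply_apply,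
    InnerProductSpace.toDual_apply_apply, smul_eq_mul, nsmul_eq_mul, sub_neg_eq_add,
    inner_add_left, sum_inner, real_inner_smul_left]
  push_cast
  ring

theorem add_inner_add_le_objective (hf : Differentiable ℝ f) (hm : Monotone (deriv f))
    (hn : 0 < n) (c : ℝ) (D : Database d n) (β θ : EuclideanSpace ℝ (Fin d)) :
    f 0 + inner ℝ ((1 / n : ℝ) • (β - critNoise f c D 0)) θ + c * ‖θ‖ ^ 2 ≤
      objective f c D β θ := by
  have hn' : (n : ℝ) ≠ 0 := by positivity
  have hloss (i : Fin n) : f 0 + inner ℝ (gradient (loss f (D i)) 0) θ ≤ loss f (D i) θ := by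
    simpa [loss] using loss_add_inner_gradient_le hf hm (D i) 0 θ
  calc f 0 + inner ℝ ((1 / n : ℝ) • (β - critNoise f c D 0)) θ + c * ‖θ‖ ^ 2
      = (1 / n : ℝ) * ∑ i, (f 0 + inner ℝ (gradient (loss f (D i)) 0) θ + c * ‖θ‖ ^ 2) +
          (1 / n : ℝ) * inner ℝ β θ := by
        simp only [critNoise, smul_zero, add_zero, sub_neg_eq_add, inner_add_left, sum_inner,
          real_inner_smul_left, Finset.sum_add_distrib, Finset.sum_const, Finset.card_univ,
          Fintype.card_fin, nsmul_eq_mul]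
        field_simp
        ring
    _ ≤ objective f c D β θ := by
        rw [objective]
        gcongr with i
        exact hloss i

theorem exists_forall_objective_le (hf : Differentiable ℝ f) (hm : Monotone (deriv f))
    (hn : 0 < n) (hc : 0 < c) (D : Database d n) (β : EuclideanSpace ℝ (Fin d)) :
    ∃ θ, ∀ θ', objective f c D β θ ≤ objective f c D β θ' := by
  have hcont : Continuous (objective f c D β) := continuous_iff_continuousAt.2 fun θ =>
    (hasGradientAt_objective hf c D β θ).hasFDerivAt.continuousAt
  set w := (1 / n : ℝ) • (β - critNoise f c D 0)
  have hlow (θ : EuclideanSpace ℝ (Fin d)) :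
      f 0 + ‖θ‖ * (c * ‖θ‖ + -‖w‖) ≤ objective f c D β θ := by
    linarith [add_inner_add_le_objective hf hm hn c D β θ,
      (abs_le.1 (abs_real_inner_le_norm w θ)).1]
  have hnorm := tendsto_norm_cocompact_atTop (E := EuclideanSpace ℝ (Fin d))
  exact hcont.exists_forall_le (Filter.tendsto_atTop_mono hlow
    (Filter.tendsto_atTop_add_const_left _ _ (hnorm.atTop_mul_atTop₀
      (Filter.tendsto_atTop_add_const_right _ _ (hnorm.const_mul_atTop hc)))))

theorem critNoise_argmin (hf : Differentiable ℝ f) (hm : Monotone (deriv f)) (hn : 0 < n)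
    (hc : 0 < c) (D : Database d n) (β : EuclideanSpace ℝ (Fin d)) :
    critNoise f c D (argmin (objective f c D β)) = β := by
  have hmin : ∀ θ', objective f c D β (argmin (objective f c D β)) ≤ objective f c D β θ' :=
    Classical.epsilon_spec (exists_forall_objective_le hf hm hn hc D β)
  have hloc : IsLocalMin (objective f c D β) (argmin (objective f c D β)) :=
    Filter.Eventually.of_forall hmin
  have hgrad := hloc.hasFDerivAt_eq_zero
    (hasGradientAt_objective hf c D β _).hasFDerivAt
  have hn' : (1 / n : ℝ) ≠ 0 := by positivity
  exact (sub_eq_zero.1 ((smul_eq_zero_iff_right hn').1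
    ((map_eq_zero_iff _ (LinearIsometryEquiv.injective _)).1 hgrad))).symm

theorem argmin_critNoise (hf : Differentiable ℝ f) (hm : Monotone (deriv f)) (hn : 0 < n)
    (hc : 0 < c) (D : Database d n) (θ : EuclideanSpace ℝ (Fin d)) :
    argmin (objective f c D (critNoise f c D θ)) = θ :=
  critNoise_injective hf hm hn hc D (critNoise_argmin hf hm hn hc D _)

theorem measurable_argmin_objective (hf : Differentiable ℝ f) (hf' : Differentiable ℝ (deriv f))
    (hm : Monotone (deriv f)) (hn : 0 < n) (hc : 0 < c) (D : Database d n) :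
    Measurable fun β => argmin (objective f c D β) :=
  measurable_of_inverse_hasFDerivAt (argmin_critNoise hf hm hn hc D)
    (critNoise_argmin hf hm hn hc D) (hasFDerivAt_critNoise hf hf' hn c D)

end CriticalNoise

section ObjectivePerturbation

variable {d n : ℕ} {f : ℝ → ℝ} {t c φ : ℝ} {D D' : Database d n}

theorem posDef_hessianMat (hf : Differentiable ℝ f) (hf' : Differentiable ℝ (deriv f))
    (hm : Monotone (deriv f)) (hc : 0 < c) (D : Database d n) (θ : EuclideanSpace ℝ (Fin d)) :
    (hessianMat f c θ D).PosDef :=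
  posDef_add_smul_one (.smul (Matrix.posSemidef_sum _ fun i _ =>
    posSemidef_hessian_loss hf hf' hm (D i) θ) (by positivity)) (by positivity)

theorem det_hessianMat_le_of_neighbor (hf : Differentiable ℝ f)
    (hf' : Differentiable ℝ (deriv f)) (hm : Monotone (deriv f))
    (hf2 : ∀ z, |deriv (deriv f) z| ≤ t) (hc : 0 < c) (h : Neighbor D D')
    (θ : EuclideanSpace ℝ (Fin d)) :
    (hessianMat f c θ D).det ≤ (1 + t / (2 * n * c)) * (hessianMat f c θ D').det := by
  obtain ⟨i, hD'⟩ := h.exists_sum_eq_sum_erase_add fun r => hessian (loss f r) θ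
  have hn : 0 < n := i.pos
  set B := (1 / n : ℝ) • ∑ j ∈ Finset.univ.erase i, hessian (loss f (D j)) θ with hB
  have hBpos : B.PosSemidef := .smul (Matrix.posSemidef_sum _ fun j _ =>
    posSemidef_hessian_loss hf hf' hm (D j) θ) (by positivity)
  have hc2 : 0 < 2 * c := by positivity
  have hcurv (r : Record d) : 0 ≤ (1 / n : ℝ) * deriv (deriv f) (r.y * inner ℝ θ r.x) :=
    mul_nonneg (by positivity) hm.deriv_nonneg
  have hD : hessianMat f c θ D = B + (2 * c) • 1 + ((1 / n : ℝ) *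
      deriv (deriv f) ((D i).y * inner ℝ θ (D i).x)) • Matrix.vecMulVec (D i).x (D i).x := by
    rw [hessianMat, ← Finset.sum_erase_add _ _ (Finset.mem_univ i), smul_add, ← hB,
      hessian_loss hf hf', smul_smul]
    abel
  have hle : (B + (2 * c) • 1).det ≤ (hessianMat f c θ D').det := by
    rw [hessianMat, hD', smul_add, ← hB, hessian_loss hf hf', smul_smul, add_right_comm]
    exact det_le_det_add_smul_vecMulVec (posDef_add_smul_one hBpos hc2) (hcurv _) _
  have ht : 0 ≤ t := (abs_nonneg _).trans (hf2 0)
  calc (hessianMat f c θ D).det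
      ≤ (1 + (1 / n : ℝ) * deriv (deriv f) ((D i).y * inner ℝ θ (D i).x) *
          ((D i).x.ofLp ⬝ᵥ (D i).x.ofLp / (2 * c))) * (B + (2 * c) • 1).det := by
        rw [hD]
        exact det_add_smul_vecMulVec_le hBpos hc2 (hcurv _) _
    _ ≤ (1 + (1 / n : ℝ) * t * (1 / (2 * c))) * (hessianMat f c θ D').det := by
        have hdet := (posDef_add_smul_one hBpos hc2).det_pos
        have hx : 0 ≤ (D i).x.ofLp ⬝ᵥ (D i).x.ofLp := dotProduct_star_self_nonneg _
        gcongr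
        · exact (le_abs_self _).trans (hf2 _)
        · exact (D i).dotProduct_self_le
    _ = (1 + t / (2 * n * c)) * (hessianMat f c θ D').det := by
        field_simp

theorem norm_critNoise_sub_le_of_neighbor (hf : Differentiable ℝ f)
    (hf1 : ∀ z, |deriv f z| ≤ 1) (c : ℝ) (h : Neighbor D D') (θ : EuclideanSpace ℝ (Fin d)) :
    ‖critNoise f c D' θ - critNoise f c D θ‖ ≤ 2 := by
  obtain ⟨i, hD'⟩ := h.exists_sum_eq_sum_erase_add fun r => gradient (loss f r) θ
  have hsub : critNoise f c D' θ - critNoise f c D θ =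
      gradient (loss f (D i)) θ - gradient (loss f (D' i)) θ := by
    rw [critNoise, critNoise, hD', ← Finset.sum_erase_add (s := Finset.univ)
      (f := fun j => gradient (loss f (D j)) θ) (Finset.mem_univ i)]
    abel
  calc ‖critNoise f c D' θ - critNoise f c D θ‖
      ≤ ‖gradient (loss f (D i)) θ‖ + ‖gradient (loss f (D' i)) θ‖ := hsub ▸ norm_sub_le _ _
    _ ≤ 1 + 1 := by gcongr <;> exact norm_gradient_loss_le hf hf1 _ θ
    _ = 2 := one_add_one_eq_two

theorem epsPrime_pos (hn : 0 < n) (ht : 0 ≤ t) (hφ : 0 < φ) (hc0 : 0 < c)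
    (hc : t / (2 * n * (Real.exp φ - 1)) < c) : 0 < epsPrime n φ t c := by
  have hexp : 0 < Real.exp φ - 1 := sub_pos.2 (Real.one_lt_exp_iff.2 hφ)
  rw [epsPrime, sub_pos, Real.log_lt_iff_lt_exp (by positivity), ← lt_sub_iff_add_lt',
    div_lt_iff₀ (by positivity)]
  rw [div_lt_iff₀ (by positivity)] at hc
  linarith

theorem exp_eq_mul_exp_epsPrime (ht : 0 ≤ t) (hc : 0 < c) :
    Real.exp φ = (1 + t / (2 * n * c)) * Real.exp (epsPrime n φ t c) := by
  have hpos : 0 < 1 + t / (2 * n * c) := by positivity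
  rw [epsPrime, Real.exp_sub, Real.exp_log hpos, mul_div_cancel₀ _ hpos.ne']

theorem isProbabilityMeasure_objPerturb (hf : Differentiable ℝ f)
    (hf' : Differentiable ℝ (deriv f)) (hm : Monotone (deriv f)) (hn : 0 < n) (hc : 0 < c)
    (hε : 0 < epsPrime n φ t c) (D : Database d n) :
    IsProbabilityMeasure (objPerturb f φ t c D) := by
  have := isProbabilityMeasure_sphericalLaplace (ι := Fin d) (half_pos hε)
  exact Measure.isProbabilityMeasure_map
    (measurable_argmin_objective hf hf' hm hn hc D).aemeasurable

theorem objPerturb_le_of_neighbor (hf : Differentiable ℝ f) (hf' : Differentiable ℝ (deriv f))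
    (hm : Monotone (deriv f)) (hf1 : ∀ z, |deriv f z| ≤ 1)
    (hf2 : ∀ z, |deriv (deriv f) z| ≤ t) (hn : 0 < n) (hc : 0 < c)
    (hε : 0 < epsPrime n φ t c) (h : Neighbor D D') :
    objPerturb f φ t c D ≤ ENNReal.ofReal (Real.exp φ) • objPerturb f φ t c D' := by
  set ε' := epsPrime n φ t c
  have ht : 0 ≤ t := (abs_nonneg _).trans (hf2 0)
  refine map_sphericalLaplace_le_of_inverse (Real.exp_pos φ).le
    (argmin_critNoise hf hm hn hc D) (critNoise_argmin hf hm hn hc D)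
    (hasFDerivAt_critNoise hf hf' hn c D) (argmin_critNoise hf hm hn hc D')
    (critNoise_argmin hf hm hn hc D') (hasFDerivAt_critNoise hf hf' hn c D') fun θ => ?_
  have hnoise : Real.exp (-(ε' / 2) * ‖critNoise f c D θ‖) ≤
      Real.exp ε' * Real.exp (-(ε' / 2) * ‖critNoise f c D' θ‖) := by
    rw [← Real.exp_add, Real.exp_le_exp]
    nlinarith [norm_le_norm_add_norm_sub' (critNoise f c D' θ) (critNoise f c D θ),
      norm_critNoise_sub_le_of_neighbor hf hf1 c h θ]
  rw [abs_det_neg_smul_toEuclideanCLM n.cast_nonneg, abs_det_neg_smul_toEuclideanCLM n.cast_nonneg,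
    abs_of_pos (posDef_hessianMat hf hf' hm hc D θ).det_pos,
    abs_of_pos (posDef_hessianMat hf hf' hm hc D' θ).det_pos]
  have hdet' := (posDef_hessianMat hf hf' hm hc D' θ).det_pos
  calc (n : ℝ) ^ d * (hessianMat f c θ D).det * Real.exp (-(ε' / 2) * ‖critNoise f c D θ‖)
      ≤ n ^ d * ((1 + t / (2 * n * c)) * (hessianMat f c θ D').det) *
          (Real.exp ε' * Real.exp (-(ε' / 2) * ‖critNoise f c D' θ‖)) := by
        gcongr
        exact det_hessianMat_le_of_neighbor hf hf' hm hf2 hc h θ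
    _ = _ := by
        rw [exp_eq_mul_exp_epsPrime (φ := φ) (n := n) ht hc]
        ring

end ObjectivePerturbation

section AdaptiveComposition

variable {α β γ Ω : Type*} [MeasurableSpace α] [MeasurableSpace β] [MeasurableSpace γ]
  [MeasurableSpace Ω] {μ : Measure α} {ν : Measure β} {κ : Kernel α β} {η : Kernel α γ}

theorem map_bind_kernel {f : α → β} (hf : Measurable f) (κ : Kernel β Ω) :
    (μ.map f).bind κ = μ.bind fun a => κ (f a) := by
  rw [← Measure.deterministic_comp_eq_map hf, Measure.comp_assoc,
    Kernel.comp_deterministic_eq_comap]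
  rfl

theorem bind_bind_eq_compProd_bind [SFinite μ] [IsSFiniteKernel κ] (ξ : Kernel (α × β) Ω) :
    (μ.bind fun a => (κ a).bind fun b => ξ (a, b)) = (μ ⊗ₘ κ).bind ξ := by
  rw [Measure.compProd_eq_comp_prod, Measure.comp_assoc]
  congr 1 with a : 1
  rw [Kernel.comp_apply, Kernel.prod_apply, Kernel.id_apply, Measure.dirac_prod,
    map_bind_kernel measurable_prodMk_left]

theorem bind_bind_bind_eq_compProd_bind [SFinite μ] [IsSFiniteKernel κ] [IsSFiniteKernel η]
    (ξ : Kernel (α × β × γ) Ω) :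
    (μ.bind fun a => (κ a).bind fun b => (η a).bind fun g => ξ (a, b, g)) =
      (μ ⊗ₘ (κ ×ₖ η)).bind ξ := by
  rw [← bind_bind_eq_compProd_bind]
  congr 1 with a : 1
  rw [Kernel.prod_apply, ← Measure.compProd_const]
  have hinner := bind_bind_eq_compProd_bind (μ := κ a) (κ := Kernel.const β (η a))
    (ξ.comap (Prod.mk a) measurable_prodMk_left)
  simpa only [Kernel.const_apply, Kernel.comap_apply] using! hinner

theorem bind_map_eq_map_prod [SFinite μ] [SFinite ν] {F : α × β → Ω} (hF : Measurable F) :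
    (μ.bind fun a => ν.map fun b => F (a, b)) = (μ.prod ν).map F := by
  rw [← Measure.compProd_const, ← Measure.deterministic_comp_eq_map hF,
    ← bind_bind_eq_compProd_bind]
  congr 1 with a : 1
  exact (Measure.bind_dirac_eq_map ν (hF.comp measurable_prodMk_left)).symm

theorem HolderDom.bind_bind_bind {μ' : Measure α} {κ' : Kernel α β} {η' : Kernel α γ}
    [SFinite μ] [SFinite μ'] [IsSFiniteKernel κ] [IsSFiniteKernel κ'] [IsSFiniteKernel η]
    [IsSFiniteKernel η'] {q : ℝ} {C₁ C₂ C₃ : ℝ≥0∞} (hq : 1 ≤ q) (hμ : HolderDom q C₁ μ μ')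
    (hκ : ∀ a, HolderDom q C₂ (κ a) (κ' a)) (hη : ∀ a, HolderDom q C₃ (η a) (η' a))
    (ξ : Kernel (α × β × γ) Ω) [IsMarkovKernel ξ] :
    HolderDom q (C₁ * (C₂ * C₃))
      (μ.bind fun a => (κ a).bind fun b => (η a).bind fun g => ξ (a, b, g))
      (μ'.bind fun a => (κ' a).bind fun b => (η' a).bind fun g => ξ (a, b, g)) := by
  have hq' : 0 < q := zero_lt_one.trans_le hq
  rw [bind_bind_bind_eq_compProd_bind, bind_bind_bind_eq_compProd_bind]
  refine (hμ.compProd hq' fun a => ?_).bind hq ξ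
  rw [Kernel.prod_apply, Kernel.prod_apply]
  exact (hκ a).prod hq' (hη a)

end AdaptiveComposition

section ReleasedMatrices

variable {α : Type*} [MeasurableSpace α] {d n : ℕ}

theorem measurable_hessianMat (f : ℝ → ℝ) (c : ℝ) (D : Database d n) :
    Measurable fun θ => hessianMat f c θ D := by
  rw [measurable_matrix_iff]
  intro i j
  simp only [hessianMat, hessian, Matrix.add_apply, Matrix.smul_apply, Matrix.sum_apply,
    Matrix.of_apply, smul_eq_mul]
  refine ((Finset.measurable_fun_sum _ fun k _ => ?_).const_mul _).add_const _
  exact measurable_fderiv_apply_const ℝ _ _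

theorem measurable_gradient (g : EuclideanSpace ℝ (Fin d) → ℝ) : Measurable (gradient g) :=
  ((InnerProductSpace.toDual ℝ (EuclideanSpace ℝ (Fin d))).symm.continuous.measurable).comp
    (measurable_fderiv ℝ g)

theorem measurable_covMat (f : ℝ → ℝ) (c : ℝ) (D : Database d n) :
    Measurable fun θ => covMat f c θ D := by
  rw [measurable_matrix_iff]
  intro i j
  have hgrad (k : Fin n) (l : Fin d) : Measurable fun θ => gradient (loss f (D k)) θ l :=
    (measurable_pi_apply l).comp
      ((WithLp.measurable_ofLp 2 _).comp (measurable_gradient (loss f (D k))))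
  simp only [covMat, Matrix.sub_apply, Matrix.smul_apply, Matrix.sum_apply,
    Matrix.vecMulVec_apply, smul_eq_mul]
  exact ((Finset.measurable_fun_sum _ fun k _ => (hgrad k i).mul (hgrad k j)).const_mul _).sub
    (Measurable.const_mul (by fun_prop) _)

/-- `privSPDMat` on the matrix `F a` with sensitivity `s a`, as a kernel in `a`. -/
noncomputable def privSPDMatKernel (mode : Mode) (F : α → Matrix (Fin d) (Fin d) ℝ) (s : α → ℝ≥0)
    (φ c : ℝ) : Kernel α (Matrix (Fin d) (Fin d) ℝ) :=
  noiseKernel (matrixNoise d mode 1 φ) fun p => spdSample c ((F p.1, s p.1), p.2)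

variable {mode : Mode} {F : α → Matrix (Fin d) (Fin d) ℝ} {s : α → ℝ≥0} {φ c : ℝ}

theorem measurable_spdSample_comp (hF : Measurable F) (hs : Measurable s) (c : ℝ) :
    Measurable fun p : α × EuclideanSpace ℝ (Fin d × Fin d) =>
      spdSample c ((F p.1, s p.1), p.2) :=
  (measurable_spdSample c).comp (by fun_prop)

theorem privSPDMatKernel_apply (hF : Measurable F) (hs : Measurable s) (hφ : 0 < φ) (a : α) :
    privSPDMatKernel mode F s φ c a = privSPDMat mode (F a) (s a) φ c := by
  have := isProbabilityMeasure_matrixNoise (d := d) mode 1 hφ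
  rw [privSPDMatKernel, noiseKernel_apply (measurable_spdSample_comp hF hs c),
    privSPDMat_eq_map_spdSample mode (F a) (s a) hφ]

theorem isMarkovKernel_privSPDMatKernel (hF : Measurable F) (hs : Measurable s) (hφ : 0 < φ) :
    IsMarkovKernel (privSPDMatKernel mode F s φ c) :=
  have := isProbabilityMeasure_matrixNoise (d := d) mode 1 hφ
  isMarkovKernel_noiseKernel (measurable_spdSample_comp hF hs c)

end ReleasedMatrices

section PostProcessing

variable {α : Type*} [MeasurableSpace α] {d m n : ℕ} {γ : ℝ} {ci : (Fin m → ℝ) → ℝ × ℝ}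

theorem measurable_toLp_mulVec {A : α → Matrix (Fin d) (Fin d) ℝ}
    {v : α → EuclideanSpace ℝ (Fin d)} (hA : Measurable A) (hv : Measurable v) :
    Measurable fun a => WithLp.toLp 2 (A a *ᵥ (v a).ofLp) := by
  refine (WithLp.measurable_toLp 2 _).comp (measurable_pi_iff.2 fun k => ?_)
  simp only [Matrix.mulVec, dotProduct]
  exact Finset.measurable_fun_sum _ fun l _ =>
    (measurable_matrix_iff.1 hA k l).mul (by fun_prop)

open scoped MatrixOrder in
/-- The linear map that takes a standard Gaussian vector to one with law
`multivariateGaussian 0 S`. -/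
noncomputable def gaussianSample (S : Matrix (Fin d) (Fin d) ℝ) (x : EuclideanSpace ℝ (Fin d)) :
    EuclideanSpace ℝ (Fin d) :=
  WithLp.toLp 2 (CFC.sqrt S *ᵥ x.ofLp)

theorem measurable_gaussianSample {S : α → Matrix (Fin d) (Fin d) ℝ}
    {x : α → EuclideanSpace ℝ (Fin d)} (hS : Measurable S) (hx : Measurable x) :
    Measurable fun a => gaussianSample (S a) (x a) :=
  measurable_toLp_mulVec (measurable_matrix_sqrt.comp hS) hx

theorem pi_multivariateGaussian_eq_map (m : ℕ) (S : Matrix (Fin d) (Fin d) ℝ) :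
    (Measure.pi fun _ : Fin m => multivariateGaussian 0 S) =
      (Measure.pi fun _ : Fin m => stdGaussian (EuclideanSpace ℝ (Fin d))).map
        fun x i => gaussianSample S (x i) := by
  have hmap : multivariateGaussian 0 S =
      (stdGaussian (EuclideanSpace ℝ (Fin d))).map (gaussianSample S) := by
    simp only [multivariateGaussian, zero_add]
    rfl
  have : SigmaFinite ((stdGaussian (EuclideanSpace ℝ (Fin d))).map (gaussianSample S)) :=
    hmap ▸ inferInstance
  rw [hmap]
  exact (Measure.pi_map_pi (f := fun _ => gaussianSample S) fun i =>
    (measurable_gaussianSample measurable_const measurable_id).aemeasurable).symm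

theorem measurable_resample {θ G β : α → EuclideanSpace ℝ (Fin d)}
    {H : α → Matrix (Fin d) (Fin d) ℝ} (hθ : Measurable θ) (hH : Measurable H)
    (hG : Measurable G) (hβ : Measurable β) :
    Measurable fun a => resample n (θ a) (H a) (G a) (β a) :=
  hθ.add ((measurable_toLp_mulVec (measurable_matrix_inv.comp hH)
    (hG.add (hβ.fun_const_smul _))).fun_const_smul _)

/-- The output of the algorithm as a function of the released parameter `θ` and Hessian `H` and of
the samples `G`, `B` of the post-processing step. -/
noncomputable def resampleIntervals (n : ℕ) (ci : (Fin m → ℝ) → ℝ × ℝ)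
    (θ : EuclideanSpace ℝ (Fin d)) (H : Matrix (Fin d) (Fin d) ℝ)
    (G B : Fin m → EuclideanSpace ℝ (Fin d)) : (Fin d → ℝ) × (Fin d → ℝ) :=
  (fun j => (ci fun i => resample n θ H (G i) (B i) j).1,
   fun j => (ci fun i => resample n θ H (G i) (B i) j).2)

theorem measurable_resampleIntervals (hci : Measurable ci) {θ : α → EuclideanSpace ℝ (Fin d)}
    {H : α → Matrix (Fin d) (Fin d) ℝ} {G B : α → Fin m → EuclideanSpace ℝ (Fin d)}
    (hθ : Measurable θ) (hH : Measurable H) (hG : Measurable G) (hB : Measurable B) :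
    Measurable fun a => resampleIntervals n ci (θ a) (H a) (G a) (B a) := by
  have hcoord (j : Fin d) (i : Fin m) :
      Measurable fun a => resample n (θ a) (H a) (G a i) (B a i) j :=
    (measurable_pi_apply j).comp ((WithLp.measurable_ofLp 2 _).comp
      (measurable_resample hθ hH (by fun_prop) (by fun_prop)))
  have hinterval (j : Fin d) :
      Measurable fun a => ci fun i => resample n (θ a) (H a) (G a i) (B a i) j :=
    hci.comp (measurable_pi_iff.2 (hcoord j))
  exact (measurable_pi_iff.2 fun j => (hinterval j).fst).prodMk
    (measurable_pi_iff.2 fun j => (hinterval j).snd)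

/-- The post-processing step as a function of the released parameter and matrices `p.1`, and of
standard Gaussian and spherical Laplace samples `p.2`. -/
noncomputable def postProcessSample (n : ℕ) (ci : (Fin m → ℝ) → ℝ × ℝ)
    (p : (EuclideanSpace ℝ (Fin d) × Matrix (Fin d) (Fin d) ℝ × Matrix (Fin d) (Fin d) ℝ) ×
      (Fin m → EuclideanSpace ℝ (Fin d)) × (Fin m → EuclideanSpace ℝ (Fin d))) :
    (Fin d → ℝ) × (Fin d → ℝ) :=
  resampleIntervals n ci p.1.1 p.1.2.1 (fun i => gaussianSample p.1.2.2 (p.2.1 i)) p.2.2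

theorem measurable_postProcessSample (hci : Measurable ci) :
    Measurable (postProcessSample (d := d) n ci) :=
  measurable_resampleIntervals hci (by fun_prop) (by fun_prop)
    (measurable_pi_iff.2 fun i => measurable_gaussianSample (by fun_prop) (by fun_prop))
    (by fun_prop)

/-- The post-processing step of the algorithm as a kernel in the released parameter and
matrices. -/
noncomputable def postProcess (d n : ℕ) (γ : ℝ) (ci : (Fin m → ℝ) → ℝ × ℝ) :
    Kernel (EuclideanSpace ℝ (Fin d) × Matrix (Fin d) (Fin d) ℝ × Matrix (Fin d) (Fin d) ℝ)
      ((Fin d → ℝ) × (Fin d → ℝ)) :=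
  noiseKernel ((Measure.pi fun _ : Fin m => stdGaussian (EuclideanSpace ℝ (Fin d))).prod
    (Measure.pi fun _ : Fin m => sphericalLaplace (Fin d) γ)) (postProcessSample n ci)

theorem postProcess_apply (hγ : 0 < γ) (hci : Measurable ci) (θ : EuclideanSpace ℝ (Fin d))
    (H S : Matrix (Fin d) (Fin d) ℝ) :
    postProcess d n γ ci (θ, H, S) =
      (Measure.pi fun _ : Fin m => multivariateGaussian 0 S).bind fun G =>
        (Measure.pi fun _ : Fin m => sphericalLaplace (Fin d) γ).map fun B =>
          resampleIntervals n ci θ H G B := by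
  have := isProbabilityMeasure_sphericalLaplace (ι := Fin d) hγ
  have hgauss : Measurable fun (x : Fin m → EuclideanSpace ℝ (Fin d)) i => gaussianSample S (x i) :=
    measurable_pi_iff.2 fun i => measurable_gaussianSample measurable_const (measurable_pi_apply i)
  have hint : Measurable fun p : (Fin m → EuclideanSpace ℝ (Fin d)) ×
      (Fin m → EuclideanSpace ℝ (Fin d)) => resampleIntervals n ci θ H p.1 p.2 :=
    measurable_resampleIntervals hci measurable_const measurable_const measurable_fst
      measurable_snd
  rw [postProcess, noiseKernel_apply (measurable_postProcessSample hci),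
    pi_multivariateGaussian_eq_map, bind_map_eq_map_prod hint,
    ← Measure.map_id (μ := Measure.pi fun _ : Fin m => sphericalLaplace (Fin d) γ),
    Measure.map_prod_map _ _ hgauss measurable_id,
    Measure.map_map hint (hgauss.prodMap measurable_id), Measure.map_id]
  rfl

theorem isMarkovKernel_postProcess (hγ : 0 < γ) (hci : Measurable ci) :
    IsMarkovKernel (postProcess d n γ ci) :=
  have := isProbabilityMeasure_sphericalLaplace (ι := Fin d) hγ
  isMarkovKernel_noiseKernel (measurable_postProcessSample hci)

end PostProcessing

section ConfidenceIntervals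

variable {d n m : ℕ} {mode : Mode} {f : ℝ → ℝ} {t c φ₁ φ₂ φ₃ : ℝ}
  {sH sC : EuclideanSpace ℝ (Fin d) → ℝ≥0} {ci : (Fin m → ℝ) → ℝ × ℝ}

theorem confidenceIntervals_eq_bind (hφ₂ : 0 < φ₂) (hφ₃ : 0 < φ₃) (hε : 0 < epsPrime n φ₁ t c)
    (hci : Measurable ci) (hsH : Measurable sH) (hsC : Measurable sC) (D : Database d n) :
    confidenceIntervals mode f t c φ₁ φ₂ φ₃ sH sC ci D =
      (objPerturb f φ₁ t c D).bind fun θ =>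
      (privSPDMatKernel mode (hessianMat f c · D) sH φ₂ c θ).bind fun H =>
      (privSPDMatKernel mode (covMat f c · D) sC φ₃ c θ).bind fun S =>
        postProcess d n (epsPrime n φ₁ t c / 2) ci (θ, H, S) := by
  simp only [privSPDMatKernel_apply (measurable_hessianMat f c D) hsH hφ₂,
    privSPDMatKernel_apply (measurable_covMat f c D) hsC hφ₃, postProcess_apply (half_pos hε) hci]
  rfl

theorem isProbabilityMeasure_confidenceIntervals (hφ₂ : 0 < φ₂) (hφ₃ : 0 < φ₃)
    (hε : 0 < epsPrime n φ₁ t c) (hci : Measurable ci) (hsH : Measurable sH)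
    (hsC : Measurable sC) (D : Database d n) [IsProbabilityMeasure (objPerturb f φ₁ t c D)] :
    IsProbabilityMeasure (confidenceIntervals mode f t c φ₁ φ₂ φ₃ sH sC ci D) := by
  have := isMarkovKernel_privSPDMatKernel (mode := mode) (c := c) (measurable_hessianMat f c D)
    hsH hφ₂
  have := isMarkovKernel_privSPDMatKernel (mode := mode) (c := c) (measurable_covMat f c D)
    hsC hφ₃
  have := isMarkovKernel_postProcess (d := d) (n := n) (half_pos hε) hci
  rw [confidenceIntervals_eq_bind hφ₂ hφ₃ hε hci hsH hsC, bind_bind_bind_eq_compProd_bind]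
  infer_instance

theorem holderDom_confidenceIntervals {q : ℝ} {ρ₁ ρ₂ ρ₃ : ℝ} (hq : 1 ≤ q) (hφ₂ : 0 < φ₂)
    (hφ₃ : 0 < φ₃) (hε : 0 < epsPrime n φ₁ t c) (hci : Measurable ci) (hsH : Measurable sH)
    (hsC : Measurable sC) {D D' : Database d n}
    [SFinite (objPerturb f φ₁ t c D)] [SFinite (objPerturb f φ₁ t c D')]
    (hθ : HolderDom q (ENNReal.ofReal (Real.exp ρ₁)) (objPerturb f φ₁ t c D)
      (objPerturb f φ₁ t c D'))
    (hH : ∀ θ, HolderDom q (ENNReal.ofReal (Real.exp ρ₂))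
      (privSPDMat mode (hessianMat f c θ D) (sH θ) φ₂ c)
      (privSPDMat mode (hessianMat f c θ D') (sH θ) φ₂ c))
    (hC : ∀ θ, HolderDom q (ENNReal.ofReal (Real.exp ρ₃))
      (privSPDMat mode (covMat f c θ D) (sC θ) φ₃ c)
      (privSPDMat mode (covMat f c θ D') (sC θ) φ₃ c)) :
    HolderDom q (ENNReal.ofReal (Real.exp (ρ₁ + ρ₂ + ρ₃)))
      (confidenceIntervals mode f t c φ₁ φ₂ φ₃ sH sC ci D)
      (confidenceIntervals mode f t c φ₁ φ₂ φ₃ sH sC ci D') := by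
  have hκH (D : Database d n) := isMarkovKernel_privSPDMatKernel (mode := mode) (c := c)
    (measurable_hessianMat f c D) hsH hφ₂
  have hκC (D : Database d n) := isMarkovKernel_privSPDMatKernel (mode := mode) (c := c)
    (measurable_covMat f c D) hsC hφ₃
  have := isMarkovKernel_postProcess (d := d) (n := n) (half_pos hε) hci
  rw [confidenceIntervals_eq_bind hφ₂ hφ₃ hε hci hsH hsC,
    confidenceIntervals_eq_bind hφ₂ hφ₃ hε hci hsH hsC, Real.exp_add, Real.exp_add, mul_assoc,
    ENNReal.ofReal_mul (by positivity), ENNReal.ofReal_mul (by positivity)]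
  refine HolderDom.bind_bind_bind hq hθ (fun θ => ?_) (fun θ => ?_) _
  · simpa only [privSPDMatKernel_apply (measurable_hessianMat f c _) hsH hφ₂] using hH θ
  · simpa only [privSPDMatKernel_apply (measurable_covMat f c _) hsC hφ₃] using hC θ

end ConfidenceIntervals

end PrivCI

open PrivCI in
theorem theorem2_general {d n m : ℕ} (hn : 0 < n)
    (f : ℝ → ℝ) (hconv : ConvexOn ℝ Set.univ f)
    (hf : Differentiable ℝ f) (hf' : Differentiable ℝ (deriv f))
    (t : ℝ) (hf1 : ∀ z, |deriv f z| ≤ 1) (hf2 : ∀ z, |deriv (deriv f) z| ≤ t)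
    (φ₁ φ₂ φ₃ : ℝ) (hφ₁ : 0 < φ₁) (hφ₂ : 0 < φ₂) (hφ₃ : 0 < φ₃)
    (c : ℝ) (hc : t / (2 * n * (Real.exp φ₁ - 1)) < c)
    (ci : (Fin m → ℝ) → ℝ × ℝ) (hci : Measurable ci)
    (sH sC : EuclideanSpace ℝ (Fin d) → NNReal) (hsH : Measurable sH) (hsC : Measurable sC)
    (hH : ∀ θ, l2Sensitivity (n := n) (hessianMat f c θ) ≤ sH θ)
    (hC : ∀ θ, l2Sensitivity (n := n) (covMat f c θ) ≤ sC θ) :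
    IsDP (n := n) (φ₁ + φ₂ + φ₃) (confidenceIntervals .pureDP f t c φ₁ φ₂ φ₃ sH sC ci) ∧
    ∀ mode : Mode, IsZCDP (n := n) (φ₁ ^ 2 / 2 + φ₂ + φ₃)
      (confidenceIntervals mode f t c φ₁ φ₂ φ₃ sH sC ci) := by
  have hm : Monotone (deriv f) := monotoneOn_univ.1 (hconv.monotoneOn_deriv fun x _ => hf x)
  have ht : 0 ≤ t := (abs_nonneg _).trans (hf2 0)
  have hexp : 0 < Real.exp φ₁ - 1 := sub_pos.2 (Real.one_lt_exp_iff.2 hφ₁)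
  have hc0 : 0 < c := lt_of_le_of_lt (by positivity) hc
  have hε : 0 < epsPrime n φ₁ t c := epsPrime_pos hn ht hφ₁ hc0 hc
  have hprob := isProbabilityMeasure_objPerturb (d := d) hf hf' hm hn hc0 hε
  have hmech (mode) : IsMechanism (n := n) (confidenceIntervals mode f t c φ₁ φ₂ φ₃ sH sC ci) :=
    fun D => have := hprob D
    isProbabilityMeasure_confidenceIntervals hφ₂ hφ₃ hε hci hsH hsC D
  have hθ {D D' : Database d n} (hD : Neighbor D D') :=
    objPerturb_le_of_neighbor hf hf' hm hf1 hf2 hn hc0 hε hD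
  refine ⟨⟨hmech _, fun D D' hD V _ => ?_⟩, fun mode => ⟨hmech mode, fun D D' hD a ha => ?_⟩⟩
  all_goals
    have hMH θ := norm_toVec_sub_le_of_l2Sensitivity_le (hH θ) hD
    have hMC θ := norm_toVec_sub_le_of_l2Sensitivity_le (hC θ) hD
  · exact holderDom_one_iff.1 (holderDom_confidenceIntervals le_rfl hφ₂ hφ₃ hε hci hsH hsC
      (holderDom_one_iff.2 (hθ hD))
      (fun θ => holderDom_one_iff.2 (privSPDMat_pureDP_le hφ₂ c (hMH θ)))
      fun θ => holderDom_one_iff.2 (privSPDMat_pureDP_le hφ₃ c (hMC θ))) V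
  · have haq := Real.HolderConjugate.conjExponent ha
    have := hmech mode D'
    refine HolderDom.renyiDiv_le haq ?_
    rw [add_mul, add_mul]
    exact holderDom_confidenceIntervals haq.symm.lt.le hφ₂ hφ₃ hε hci hsH hsC
      (.of_le_smul_of_le_smul haq (hθ hD) (hθ hD.symm))
      (fun θ => holderDom_privSPDMat mode hφ₂ c (hMH θ) haq)
      fun θ => holderDom_privSPDMat mode hφ₃ c (hMC θ) haq

open PrivCI in
theorem theorem2 {d n m : ℕ} (hn : 0 < n)
    (f : ℝ → ℝ) (hconv : ConvexOn ℝ Set.univ f)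
    (hf : Differentiable ℝ f) (hf' : Differentiable ℝ (deriv f))
    (t : ℝ) (hf1 : ∀ z, |deriv f z| ≤ 1) (hf2 : ∀ z, |deriv (deriv f) z| ≤ t)
    (φ₁ φ₂ φ₃ : ℝ) (hφ₁ : 0 < φ₁) (hφ₂ : 0 < φ₂) (hφ₃ : 0 < φ₃)
    (c : ℝ) (hc : t / (2 * n * (Real.exp φ₁ - 1)) < c)
    (α : ℝ) (ci : (Fin m → ℝ) → ℝ × ℝ) (hci : PrivCI.IsIntervalRule α ci)
    (sH sC : EuclideanSpace ℝ (Fin d) → NNReal) (hsH : Measurable sH) (hsC : Measurable sC)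
    (hH : ∀ θ, PrivCI.l2Sensitivity (n := n) (PrivCI.hessianMat f c θ) ≤ sH θ)
    (hC : ∀ θ, PrivCI.l2Sensitivity (n := n) (PrivCI.covMat f c θ) ≤ sC θ) :
    PrivCI.IsDP (n := n) (φ₁ + φ₂ + φ₃)
      (PrivCI.confidenceIntervals .pureDP f t c φ₁ φ₂ φ₃ sH sC ci) ∧
    ∀ mode : PrivCI.Mode, PrivCI.IsZCDP (n := n) (φ₁ ^ 2 / 2 + φ₂ + φ₃)
      (PrivCI.confidenceIntervals mode f t c φ₁ φ₂ φ₃ sH sC ci) :=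
  theorem2_general hn f hconv hf hf' t hf1 hf2 φ₁ φ₂ φ₃ hφ₁ hφ₂ hφ₃ c hc ci hci.measurable
    sH sC hsH hsC hH hC
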